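/- Let $\mathbb K\in\{\mathbb R,\mathbb C\}$. A \emph{continuous inverse algebra} over $\mathbb K$ is a unital associative $\mathbb K$-algebra $A$ with a Hausdorff locally convex vector topology for which the multiplication is continuous, the group $A^\times$ of invertible elements is open in $A$, and inversion $A^\times\to A$, $x\mapsto x^{-1}$, is continuous. Its unit group $A^\times$ is considered as a manifold modelled on the real locally convex space $A$, being an open subset of $A$. The algebra $A$ is called \emph{locally m-convex} if its topology is defined by a set of seminorms $q$ with $q(xy)\le q(x)q(y)$ for all $x,y\in A$. A locally convex space $E$ is called \emph{Mackey-complete} if every Lipschitz curve $\gamma\colon[0,1]\to E$ (that is, $\{(\gamma(t)-\gamma(s))/(t-s) : s\neq t\}$ is bounded in $E$) has a Riemann integral in $E$. Smooth maps between real locally convex spaces are continuous maps on open sets all of whose iterated directional derivatives $d^{(k)}f(x,y_1,\dots,y_k)$ exist and are continuous in $(x,y_1,\dots,y_k)$ jointly; smooth maps between manifolds are defined through charts. A Lie group $G$ modelled on a locally convex space, with Lie algebra $\mathfrak g=T_1G$, is called \emph{regular} (in Milnor's sense) if each $\gamma\in C^\infty([0,1],\mathfrak g)$ has an evolution, that is,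 a $C^1$-curve $\eta_\gamma\colon[0,1]\to G$ with $\eta_\gamma(0)=1$ and $\eta_\gamma'(t)=\eta_\gamma(t)\gamma(t)$ for all $t\in[0,1]$ (where $gv:=T_1(\lambda_g)(v)$ for $g\in G$, $v\in\mathfrak g$, and $\lambda_g(x)=gx$), and the map $C^\infty([0,1],\mathfrak g)\to G$, $\gamma\mapsto\eta_\gamma(1)$, is smooth, where $C^\infty([0,1],\mathfrak g)$ carries the topology of uniform convergence of curves and of all their derivatives. \textbf{Corollary.} Let $A$ be a Mackey-complete continuous inverse algebra over $\mathbb K$. If $A$ is commutative or locally m-convex, then $A^\times$ is a regular Lie group: it is a Lie group modelled on $A$ (its multiplication and inversion are smooth), and it is regular in Milnor's sense. -/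

import Mathlib

open Filter Set
open scoped Topology unitInterval

noncomputable section

/-! ## Directional derivatives and smooth maps between locally convex spaces -/

/-- `f` has the directional derivative `v` at `x` in the direction `y`: the difference quotients
`t⁻¹ (f (x + t y) - f x)` converge to `v` as `t → 0`, `t ≠ 0`. -/
def HasDirDerivAt {E F : Type*} [AddCommGroup E] [Module ℝ E]
    [AddCommGroup F] [Module ℝ F] [TopologicalSpace F]
    (f : E → F) (v : F) (x y : E) : Prop :=
  Tendsto (fun t : ℝ => t⁻¹ • (f (x + t • y) - f x)) (𝓝[≠] 0) (𝓝 v)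

/-- Smooth maps (in the sense of Michal and Bastiani) on an open subset `U` of a real locally
convex space `E`, with values in a real locally convex space `F`: `f` is continuous, all iterated
directional derivatives `d k x (y₁, …, y_k) = (D_{y_k} ⋯ D_{y₁} f) x` exist for `x ∈ U`, and they
are continuous as maps `U × E ^ k → F`. -/
def IsSmoothOn {E F : Type*} [AddCommGroup E] [Module ℝ E] [TopologicalSpace E]
    [AddCommGroup F] [Module ℝ F] [TopologicalSpace F] (f : E → F) (U : Set E) : Prop :=
  ∃ d : (k : ℕ) → E → (Fin k → E) → F,
    (∀ x ∈ U, ∀ y, d 0 x y = f x) ∧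
    (∀ k, ∀ x ∈ U, ∀ y : Fin (k + 1) → E,
      HasDirDerivAt (fun z => d k z (Fin.init y)) (d (k + 1) x y) x (y (Fin.last k))) ∧
    ∀ k, ContinuousOn (fun p : E × (Fin k → E) => d k p.1 p.2) (U ×ˢ univ)

/-! ## Manifolds and Lie groups modelled on locally convex spaces -/

/-- A map between manifolds modelled on locally convex spaces is smooth if it is continuous and
smooth in all charts. -/
def IsSmoothMap (E F : Type*) {M N : Type*}
    [AddCommGroup E] [Module ℝ E] [TopologicalSpace E]
    [AddCommGroup F] [Module ℝ F] [TopologicalSpace F]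
    [TopologicalSpace M] [ChartedSpace E M] [TopologicalSpace N] [ChartedSpace F N]
    (f : M → N) : Prop :=
  Continuous f ∧ ∀ e ∈ atlas E M, ∀ e' ∈ atlas F N,
    IsSmoothOn (fun x => e' (f (e.symm x))) (e.target ∩ e.symm ⁻¹' (f ⁻¹' e'.source))

/-- `G`, with its given atlas of charts in the (Hausdorff, real) locally convex space `E`, is a
Lie group modelled on `E`: it is a Hausdorff smooth manifold, and multiplication and inversion
are smooth. -/
structure IsLCLieGroup (E G : Type*) [AddCommGroup E] [Module ℝ E] [TopologicalSpace E]
    [Group G] [TopologicalSpace G] [ChartedSpace E G] : Prop where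
  t2 : T2Space G
  compatible : ∀ e ∈ atlas E G, ∀ e' ∈ atlas E G,
    IsSmoothOn (fun x => e' (e.symm x)) (e.target ∩ e.symm ⁻¹' e'.source)
  smooth_mul :
    letI : ChartedSpace (E × E) (G × G) := prodChartedSpace E G E G
    IsSmoothMap (E × E) E (fun g : G × G => g.1 * g.2)
  smooth_inv : IsSmoothMap E E (fun g : G => g⁻¹)

/-! ## Curves on the unit interval -/

/-- The curve `γ : [0,1] → E` has the derivative `v` at `t` (one-sided at the end points). -/
def HasCurveDerivAt {E : Type*} [AddCommGroup E] [Module ℝ E] [TopologicalSpace E]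
    (γ : I → E) (v : E) (t : I) : Prop :=
  Tendsto (fun s : I => ((s : ℝ) - t)⁻¹ • (γ s - γ t)) (𝓝[≠] t) (𝓝 v)

/-- `D` is the sequence `γ, γ', γ'', …` of all derivatives of the curve `γ : [0,1] → E`, and all
of them are continuous. -/
def IsDerivSeq {E : Type*} [AddCommGroup E] [Module ℝ E] [TopologicalSpace E]
    (γ : I → E) (D : ℕ → C(I, E)) : Prop :=
  (∀ t, D 0 t = γ t) ∧ ∀ k t, HasCurveDerivAt (D k) (D (k + 1) t) t

theorem HasCurveDerivAt.unique {E : Type*} [AddCommGroup E] [Module ℝ E] [TopologicalSpace E]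
    [T2Space E] {γ : I → E} {v w : E} {t : I}
    (hv : HasCurveDerivAt γ v t) (hw : HasCurveDerivAt γ w t) : v = w :=
  tendsto_nhds_unique hv hw

theorem IsDerivSeq.unique {E : Type*} [AddCommGroup E] [Module ℝ E] [TopologicalSpace E]
    [T2Space E] {γ : I → E} {D D' : ℕ → C(I, E)}
    (h : IsDerivSeq γ D) (h' : IsDerivSeq γ D') : D = D' := by
  funext k
  induction k with
  | zero => ext t; rw [h.1 t, h'.1 t]
  | succ k ih =>
    ext t
    have h1 := h.2 k t
    rw [ih] at h1
    exact h1.unique (h'.2 k t)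

section SmoothPath

variable (E : Type*) [AddCommGroup E] [Module ℝ E] [TopologicalSpace E]
  [IsTopologicalAddGroup E] [ContinuousSMul ℝ E]

/-- The real vector space of all smooth curves `[0,1] → E`. -/
def smoothPathSubmodule : Submodule ℝ (I → E) where
  carrier := {γ | ∃ D, IsDerivSeq γ D}
  zero_mem' := ⟨fun _ => 0, fun _ => rfl, fun k t => by
    simpa [HasCurveDerivAt] using tendsto_const_nhds⟩
  add_mem' := by
    rintro γ γ' ⟨D, h0, h⟩ ⟨D', h0', h'⟩
    refine ⟨fun k => D k + D' k, fun t => by simp [h0 t, h0' t], fun k t => ?_⟩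
    refine ((h k t).add (h' k t)).congr fun s => ?_
    simp only [ContinuousMap.add_apply, ← smul_add]
    congr 1
    abel
  smul_mem' := by
    rintro c γ ⟨D, h0, h⟩
    refine ⟨fun k => c • D k, fun t => by simp [h0 t], fun k t => ?_⟩
    refine ((h k t).const_smul c).congr fun s => ?_
    simp only [ContinuousMap.smul_apply, ← smul_sub]
    rw [smul_comm]

/-- The space `C^∞([0,1], E)` of smooth curves; its topology is defined below. -/
def SmoothPath : Type _ := ↥(smoothPathSubmodule E)

instance : AddCommGroup (SmoothPath E) := inferInstanceAs (AddCommGroup ↥(smoothPathSubmodule E))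

instance : Module ℝ (SmoothPath E) := inferInstanceAs (Module ℝ ↥(smoothPathSubmodule E))

variable {E}

/-- The curve `[0,1] → E` underlying an element of `C^∞([0,1], E)`. -/
def SmoothPath.toFun (γ : SmoothPath E) : I → E := γ.1

/-- The `k`-th derivative of a smooth curve, as an element of `C([0,1], E)`. -/
def SmoothPath.iterDeriv (k : ℕ) (γ : SmoothPath E) : C(I, E) := Classical.choose γ.2 k

theorem SmoothPath.isDerivSeq (γ : SmoothPath E) :
    IsDerivSeq γ.toFun (fun k => γ.iterDeriv k) := Classical.choose_spec γ.2

/-- The topology of `C^∞([0,1], E)` is that of uniform convergence of the curves and of all their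
derivatives, that is, the coarsest topology making all maps `γ ↦ γ⁽ᵏ⁾` into `C([0,1], E)`
continuous, where `C([0,1], E)` carries the compact-open topology. Equivalently, it is defined by
the seminorms `γ ↦ max_{j ≤ k} max_t p (γ⁽ʲ⁾ t)` with `k : ℕ` and `p` a continuous seminorm
on `E`. -/
instance : TopologicalSpace (SmoothPath E) :=
  ⨅ k : ℕ, TopologicalSpace.induced (SmoothPath.iterDeriv k) inferInstance

end SmoothPath

/-! ## Evolutions and regularity -/

section Regular

variable (E : Type*) {G : Type*} [AddCommGroup E] [Module ℝ E] [TopologicalSpace E]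
  [Group G] [TopologicalSpace G] [ChartedSpace E G]

/-- `η : [0,1] → G` is a `C¹`-curve in the manifold `G`. -/
def IsC1Curve (η : I → G) : Prop :=
  Continuous η ∧ ∀ e ∈ atlas E G, ∃ d : I → E, ContinuousOn d (η ⁻¹' e.source) ∧
    ∀ t ∈ η ⁻¹' e.source, HasCurveDerivAt (fun s => e (η s)) (d t) t

/-- The tangent space `T_g G` is identified with `E` by means of the preferred chart at `g`. In
particular the Lie algebra `T_1 G` is identified with `E` by means of the preferred chart at `1`.
`IsLeftTranslate g v w` says that `w ∈ T_g G` is the vector `g v = T_1 (λ_g) v`, the image of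
`v ∈ T_1 G` under the tangent map at `1` of the left translation `λ_g : x ↦ g x`. -/
def IsLeftTranslate (g : G) (v w : E) : Prop :=
  HasDirDerivAt (fun x => chartAt E g (g * (chartAt E (1 : G)).symm x)) w
    (chartAt E (1 : G) 1) v

variable {E}

/-- `η` is the evolution of the curve `γ` in the Lie algebra `T_1 G ≅ E` of `G`: it is a
`C¹`-curve in `G` with `η 0 = 1` and `η' t = η t γ t` for all `t`. -/
def IsEvolution (γ : I → E) (η : I → G) : Prop :=
  IsC1Curve E η ∧ η 0 = 1 ∧
    ∀ t, ∃ w : E, HasCurveDerivAt (fun s => chartAt E (η t) (η s)) w t ∧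
      IsLeftTranslate E (η t) (γ t) w

end Regular

/-- `G` is a Lie group modelled on the locally convex space `E` which is regular in Milnor's
sense: each smooth curve `γ` in the Lie algebra has an evolution `Evol γ`, and the map
`evol : C^∞([0,1], T_1 G) → G`, `γ ↦ Evol γ 1` is smooth. (Evolutions in a Lie group are
unique.) -/
structure IsRegularLieGroup (E G : Type*) [AddCommGroup E] [Module ℝ E] [TopologicalSpace E]
    [IsTopologicalAddGroup E] [ContinuousSMul ℝ E]
    [Group G] [TopologicalSpace G] [ChartedSpace E G] : Prop extends IsLCLieGroup E G where
  exists_evolution : ∃ Evol : SmoothPath E → I → G,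
    (∀ γ, IsEvolution γ.toFun (Evol γ)) ∧
    IsSmoothMap (SmoothPath E) E (fun γ => Evol γ 1)

/-! ## Mackey completeness -/

section Mackey

variable {E : Type*} [AddCommGroup E] [Module ℝ E] [TopologicalSpace E]

/-- `γ : [0,1] → E` is a Lipschitz curve: its difference quotients form a bounded set. -/
def IsLipschitzCurve (γ : I → E) : Prop :=
  Bornology.IsVonNBounded ℝ {v | ∃ s t : I, s ≠ t ∧ v = ((t : ℝ) - s)⁻¹ • (γ t - γ s)}

/-- `v` is the Riemann integral of `γ` over `[0,1]`: the Riemann sums of `γ` over partitions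
`0 = x 0 ≤ x 1 ≤ ⋯ ≤ x n = 1` with tags `ξ i ∈ [x i, x (i + 1)]` converge to `v` as the mesh of
the partition tends to `0`. -/
def HasRiemannIntegral (γ : I → E) (v : E) : Prop :=
  ∀ U ∈ 𝓝 v, ∃ δ > (0 : ℝ), ∀ (n : ℕ) (x ξ : ℕ → I), Monotone x → x 0 = 0 → x n = 1 →
    (∀ i < n, x i ≤ ξ i ∧ ξ i ≤ x (i + 1)) → (∀ i < n, (x (i + 1) : ℝ) - x i < δ) →
    ∑ i ∈ Finset.range n, ((x (i + 1) : ℝ) - x i) • γ (ξ i) ∈ U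

variable (E)

/-- A locally convex space is Mackey-complete if every Lipschitz curve in it has a Riemann
integral. -/
def IsMackeyComplete : Prop :=
  ∀ γ : I → E, IsLipschitzCurve γ → ∃ v, HasRiemannIntegral γ v

end Mackey

/-! ## Continuous inverse algebras -/

/-- The property which makes a unital associative (Hausdorff) locally convex topological algebra
`A` a continuous inverse algebra: the set of invertible elements is open, and the inversion map
is continuous on it. -/
class IsContinuousInverseAlgebra (A : Type*) [Ring A] [TopologicalSpace A] : Prop where
  isOpen_units : IsOpen {x : A | IsUnit x}
  continuousOn_inverse : ContinuousOn Ring.inverse {x : A | IsUnit x}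

/-- The topology of the `𝕜`-algebra `A` is defined by a set of submultiplicative seminorms. -/
def IsLocallyMConvex (𝕜 A : Type*) [RCLike 𝕜] [Ring A] [Algebra 𝕜 A] [TopologicalSpace A] :
    Prop :=
  ∃ S : Set (Seminorm 𝕜 A), (∀ q ∈ S, ∀ x y, q (x * y) ≤ q x * q y) ∧
    WithSeminorms (fun q : S => (q : Seminorm 𝕜 A))

theorem IsContinuousInverseAlgebra.isOpenEmbedding_val (A : Type*) [Ring A] [TopologicalSpace A]
    [IsContinuousInverseAlgebra A] : Topology.IsOpenEmbedding (Units.val : Aˣ → A) := by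
  have hr : range (Units.val : Aˣ → A) = {x : A | IsUnit x} := by
    ext x
    exact Iff.rfl
  refine ⟨Units.isEmbedding_val_mk' (f := Ring.inverse) continuousOn_inverse fun u => by simp, ?_⟩
  rw [hr]
  exact isOpen_units

/-- The unit group of a continuous inverse algebra `A` is a manifold modelled on `A`, being an
open subset of `A`: the inclusion `Aˣ → A` is the only chart. -/
instance unitsChartedSpace (A : Type*) [Ring A] [TopologicalSpace A]
    [IsContinuousInverseAlgebra A] : ChartedSpace A Aˣ :=
  (IsContinuousInverseAlgebra.isOpenEmbedding_val A).singletonChartedSpace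

end

-- The evolution of a curve `γ` in `A` is the solution of the linear equation `η' = η γ`, `η 0 = 1`
-- in `A`. The point is to solve it with Mackey-completeness only, and to control how the solution
-- depends on `γ`. Both succeed once every continuous seminorm is dominated by a continuous
-- submultiplicative one (`IsLocallySubmultiplicative`).
--
-- Existence. The Picard series `η = ∑ η_n`, with `η_0 = 1` and `η_{n+1}` the primitive of `η_n γ`
-- vanishing at `0`, satisfies `p (η_n t) ≤ p 1 * K ^ n / n!` for submultiplicative `p`. Each term
-- exists because Lipschitz curves have integrals. The sum exists because a rapidly decreasing
-- series is itself the integral of a Lipschitz curve, built from bumps accumulating at `0`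
-- (`HasLipschitzIntegrals.exists_weak_sum`). All integrals are tested against continuous
-- functionals; Hahn–Banach turns scalar bounds into seminorm bounds. Invertibility of `η t` comes
-- from solving `ζ' = -γ ζ` as well (`IsSolution.mul_eq_one`, `IsSolution.mul_eq_one'`).
--
-- Smoothness. Gronwall's inequality gives uniqueness and continuity in `γ`. The derivative of the
-- solution in the direction `y` is the `ε`-component of the solution of the same problem over the
-- dual numbers `A[ε]`, driven by `γ + ε y` (`IsSolution.hasDirDeriv`). Since the general problem is
-- posed for an arbitrary locally submultiplicative bilinear map, the step can be iterated: all
-- derivatives of the endpoint map are endpoint maps composed with continuous linear maps, hence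
-- continuous.
--
-- Submultiplicative seminorms. In the locally m-convex case they are given, up to finite suprema
-- and scaling. In the commutative case they are constructed: the partial fraction decomposition of
-- `1 / (1 - x ^ m)` over roots of unity bounds all powers of small elements uniformly in `m`;
-- polarization passes from powers to products of distinct elements; the gauge of the convex hull of
-- all such products is the desired seminorm.

universe u v

noncomputable section

/-! ### Continuous seminorms and the Hahn–Banach theorem -/

section Seminorms

variable {E : Type*} [AddCommGroup E] [Module ℝ E] [TopologicalSpace E]
  [IsTopologicalAddGroup E] [ContinuousSMul ℝ E] [LocallyConvexSpace ℝ E]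

theorem tendsto_nhds_iff_seminorm {ι : Type*} {l : Filter ι} {f : ι → E} {v : E} :
    Tendsto f l (𝓝 v) ↔
      ∀ p : Seminorm ℝ E, Continuous p → Tendsto (fun i => p (f i - v)) l (𝓝 0) := by
  constructor
  · intro h p hp
    have h1 : Tendsto (fun i => f i - v) l (𝓝 0) := by simpa using h.sub_const v
    simpa [Function.comp_def] using (hp.tendsto 0).comp h1
  · intro h
    rw [(PolynormableSpace.withSeminorms ℝ E).tendsto_nhds]
    intro p ε hε
    exact (h p.1 p.2).eventually (gt_mem_nhds hε)

theorem Seminorm.exists_lt_one_subset_of_mem_nhds {U : Set E} (hU : U ∈ 𝓝 (0 : E)) :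
    ∃ p : Seminorm ℝ E, Continuous p ∧ ∀ x, p x < 1 → x ∈ U := by
  have hw := PolynormableSpace.withSeminorms ℝ E
  obtain ⟨s, r, hr, hs⟩ := (hw.mem_nhds_iff 0 U).1 hU
  have hb := (hw.hasBasis_zero_ball.mem_of_mem (i := (s, r)) hr)
  set q := s.sup fun p : {p : Seminorm ℝ E // Continuous p} => p.1
  have key : ∀ x, (Real.toNNReal r⁻¹ • q) x = r⁻¹ * q x := fun x => by
    rw [smul_apply, NNReal.smul_def, Real.coe_toNNReal _ (by positivity), smul_eq_mul]
  have hsub : ∀ x, r⁻¹ * q x < 1 ↔ q x < r := fun x => by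
    rw [inv_mul_lt_iff₀ hr, mul_one]
  refine ⟨Real.toNNReal r⁻¹ • q, Seminorm.continuous (r := 1) ?_, fun x hx => ?_⟩
  · refine mem_of_superset hb fun x hx => ?_
    rw [Seminorm.mem_ball_zero] at hx ⊢
    rwa [key, hsub]
  · rw [key, hsub] at hx
    exact hs (q.mem_ball_zero.2 hx)

/-- Hahn–Banach applied to `c • v ↦ c * p v` on the line through `v`. Through
`Seminorm.le_of_forall_dual`, this reduces estimates for weak integrals and weak sums in `E` to
estimates for real integrals and series. -/
theorem Seminorm.exists_dual_eq {p : Seminorm ℝ E} (hp : Continuous p) (v : E) :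
    ∃ φ : E →L[ℝ] ℝ, φ v = p v ∧ ∀ x, |φ x| ≤ p x := by
  by_cases hv : v = 0
  · exact ⟨0, by simp [hv], fun x => by simp⟩
  obtain ⟨g, hg, hl⟩ := Module.Dual.exists_continuous_extension_of_le_seminorm_real
    (Submodule.span ℝ {v})
    ((p v) • (LinearEquiv.toSpanNonzeroSingleton ℝ E v hv).symm.toLinearMap) hp (by
      rintro ⟨x, hx⟩
      obtain ⟨c, rfl⟩ := Submodule.mem_span_singleton.1 hx
      have : (LinearEquiv.toSpanNonzeroSingleton ℝ E v hv).symm ⟨c • v, hx⟩ = c := by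
        rw [LinearEquiv.symm_apply_eq]; rfl
      simp only [LinearMap.smul_apply, LinearEquiv.coe_coe, this, map_smul_eq_mul, smul_eq_mul]
      rw [mul_comm]
      exact mul_le_mul_of_nonneg_right (le_abs_self c) (apply_nonneg p v))
  refine ⟨g, ?_, hl⟩
  have := hg ⟨v, Submodule.mem_span_singleton_self v⟩
  rw [this]
  have h1 : (LinearEquiv.toSpanNonzeroSingleton ℝ E v hv).symm
      ⟨v, Submodule.mem_span_singleton_self v⟩ = 1 := by
    rw [LinearEquiv.symm_apply_eq]; ext; simp
  simp [h1]

theorem Seminorm.le_of_forall_dual {p : Seminorm ℝ E} (hp : Continuous p) {v : E} {C : ℝ}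
    (h : ∀ φ : E →L[ℝ] ℝ, (∀ x, |φ x| ≤ p x) → φ v ≤ C) : p v ≤ C := by
  obtain ⟨φ, h1, h2⟩ := Seminorm.exists_dual_eq hp v
  exact h1 ▸ h φ h2

theorem ContinuousLinearMap.eq_of_forall_dual [T2Space E] {v w : E}
    (h : ∀ φ : E →L[ℝ] ℝ, φ v = φ w) : v = w := by
  by_contra hne
  obtain ⟨φ, hφ⟩ := SeparatingDual.exists_ne_zero (R := ℝ) (sub_ne_zero.2 hne)
  exact hφ (by rw [map_sub, h φ, sub_self])

end Seminorms


/-! ### Weak primitives of curves and Mackey-completeness -/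

section Curves

variable {E : Type*} [AddCommGroup E] [Module ℝ E] [TopologicalSpace E]

/-- The extension of a curve on `[0,1]` to a curve on `ℝ` which is constant outside `[0,1]`. -/
def unitExt {X : Type*} (f : I → X) : ℝ → X := IccExtend zero_le_one f

theorem unitExt_coe {X : Type*} (f : I → X) (t : I) : unitExt f t = f t :=
  IccExtend_val _ f t

theorem unitExt_of_mem {X : Type*} (f : I → X) {t : ℝ} (ht : t ∈ Icc (0 : ℝ) 1) :
    unitExt f t = f ⟨t, ht⟩ :=
  IccExtend_of_mem _ f ht

theorem exists_unitExt {X : Type*} (f : I → X) (t : ℝ) : ∃ s : I, unitExt f t = f s := ⟨_, rfl⟩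

theorem Continuous.unitExt {X : Type*} [TopologicalSpace X] {f : I → X} (hf : Continuous f) :
    Continuous (unitExt f) :=
  hf.Icc_extend'

theorem Continuous.exists_seminorm_bound {f : I → E} (hf : Continuous f) {p : Seminorm ℝ E}
    (hp : Continuous p) : ∃ C, 0 < C ∧ ∀ t, p (f t) ≤ C := by
  obtain ⟨C, hC⟩ := (isCompact_range (hp.comp hf)).bddAbove
  exact ⟨max C 1, by positivity, fun t => (hC ⟨t, rfl⟩).trans (le_max_left _ _)⟩

/-- A curve in a locally convex space which is Lipschitz with respect to each continuous
seminorm. -/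
def IsSeminormLipschitz (f : I → E) : Prop :=
  ∀ p : Seminorm ℝ E, Continuous p → ∃ L, 0 ≤ L ∧ ∀ s t : I, p (f s - f t) ≤ L * |(s : ℝ) - t|

/-- `F` is a primitive of `f` in the weak sense. -/
def IsWeakPrimitive (F f : I → E) : Prop :=
  ∀ (φ : E →L[ℝ] ℝ) (t : I), φ (F t) - φ (F 0) = ∫ u in (0 : ℝ)..t, φ (unitExt f u)

variable (E) in
/-- Lipschitz curves in `E` have weak integrals. -/
def HasLipschitzIntegrals : Prop :=
  ∀ f : I → E, IsSeminormLipschitz f →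
    ∃ v, ∀ φ : E →L[ℝ] ℝ, φ v = ∫ u in (0 : ℝ)..1, φ (unitExt f u)

theorem Seminorm.continuous_absComp (φ : E →L[ℝ] ℝ) :
    Continuous ((normSeminorm ℝ ℝ).comp φ.toLinearMap) := by
  have : ⇑((normSeminorm ℝ ℝ).comp φ.toLinearMap) = fun x => ‖φ x‖ := rfl
  rw [this]
  exact φ.continuous.norm

theorem IsSeminormLipschitz.dual {f : I → E} (hf : IsSeminormLipschitz f) (φ : E →L[ℝ] ℝ) :
    ∃ L, 0 ≤ L ∧ ∀ s t : I, |φ (f s) - φ (f t)| ≤ L * |(s : ℝ) - t| := by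
  obtain ⟨L, h0, hL⟩ := hf _ (Seminorm.continuous_absComp φ)
  refine ⟨L, h0, fun s t => ?_⟩
  simpa using hL s t

theorem abs_riemannSum_sub_integral_le {g : ℝ → ℝ} (hg : Continuous g) {L : ℝ}
    (hL : ∀ s ∈ Icc (0 : ℝ) 1, ∀ t ∈ Icc (0 : ℝ) 1, |g s - g t| ≤ L * |s - t|) {n : ℕ}
    (hn : 0 < n) :
    |(∑ i ∈ Finset.range n, (n : ℝ)⁻¹ * g (i / n)) - ∫ u in (0 : ℝ)..1, g u| ≤ L / n := by
  have hn' : (0 : ℝ) < n := by exact_mod_cast hn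
  have h1 := intervalIntegral.sum_integral_adjacent_intervals (f := g)
    (μ := MeasureTheory.volume) (a := fun i : ℕ => (i : ℝ) / n) (n := n)
    (fun k _ => hg.intervalIntegrable _ _)
  simp only [CharP.cast_eq_zero, zero_div, div_self hn'.ne'] at h1
  rw [← h1, ← Finset.sum_sub_distrib]
  refine (Finset.abs_sum_le_sum_abs _ _).trans ?_
  have h2 : ∀ i ∈ Finset.range n,
      |(n : ℝ)⁻¹ * g (i / n) - ∫ u in (i / n : ℝ)..((i + 1 : ℕ) / n : ℝ), g u|
        ≤ L / n * (n : ℝ)⁻¹ := by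
    intro i hi
    have hi' : (i : ℝ) + 1 ≤ n := by exact_mod_cast Finset.mem_range.1 hi
    have hlen : ((i + 1 : ℕ) / n : ℝ) - i / n = (n : ℝ)⁻¹ := by
      push_cast; field_simp; ring
    have hle : (i / n : ℝ) ≤ ((i + 1 : ℕ) / n : ℝ) := by
      have : (0 : ℝ) < (n : ℝ)⁻¹ := by positivity
      linarith
    have h3 : (n : ℝ)⁻¹ * g (i / n) = ∫ u in (i / n : ℝ)..((i + 1 : ℕ) / n : ℝ), g (i / n) := by
      rw [intervalIntegral.integral_const, hlen, smul_eq_mul]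
    rw [h3, ← intervalIntegral.integral_sub (by simp) (hg.intervalIntegrable _ _),
      ← Real.norm_eq_abs]
    have h4 := intervalIntegral.norm_integral_le_of_norm_le_const
      (f := fun u => g (i / n) - g u) (a := (i / n : ℝ)) (b := ((i + 1 : ℕ) / n : ℝ))
      (C := L / n) ?_
    · rwa [hlen, abs_of_pos (by positivity)] at h4
    · intro u hu
      rw [uIoc_of_le hle] at hu
      have hup : ((i + 1 : ℕ) / n : ℝ) ≤ 1 := by
        rw [div_le_one hn']; exact_mod_cast hi'
      have hi0 : (0 : ℝ) ≤ i / n := by positivity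
      have hL0 : 0 ≤ L := by
        have := (abs_nonneg _).trans (hL 0 (by simp) 1 (by simp))
        simpa using this
      refine (hL _ ⟨hi0, hle.trans hup⟩ u ⟨by linarith [hu.1], by linarith [hu.2]⟩).trans ?_
      rw [div_eq_mul_inv L]
      refine mul_le_mul_of_nonneg_left ?_ hL0
      rw [abs_le]
      constructor <;> linarith [hu.1, hu.2]
  refine (Finset.sum_le_sum h2).trans ?_
  rw [Finset.sum_const, Finset.card_range, nsmul_eq_mul]
  apply le_of_eq
  field_simp

theorem Continuous.intervalIntegrable_dual {f : I → E} (hf : Continuous f) (φ : E →L[ℝ] ℝ)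
    (a b : ℝ) : IntervalIntegrable (fun u => φ (_root_.unitExt f u)) MeasureTheory.volume a b :=
  (show Continuous fun u => φ (_root_.unitExt f u) from
    φ.continuous.comp hf.unitExt).intervalIntegrable a b

theorem IsWeakPrimitive.sub_eq {F f : I → E} (h : IsWeakPrimitive F f) (hf : Continuous f)
    (φ : E →L[ℝ] ℝ) (s t : I) : φ (F t) - φ (F s) = ∫ u in (s : ℝ)..t, φ (unitExt f u) := by
  have hc : Continuous fun u => φ (unitExt f u) := φ.continuous.comp hf.unitExt
  rw [← intervalIntegral.integral_interval_sub_left (hc.intervalIntegrable 0 t)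
    (hc.intervalIntegrable 0 s), ← h φ t, ← h φ s]
  ring

theorem hasDerivAt_of_hasCurveDerivAt {F : I → E} {v : E} {t : I} (h : HasCurveDerivAt F v t)
    (ht : (t : ℝ) ∈ Ioo (0 : ℝ) 1) (φ : E →L[ℝ] ℝ) :
    HasDerivAt (fun u => φ (unitExt F u)) (φ v) t := by
  rw [hasDerivAt_iff_tendsto_slope]
  have h1 : Tendsto (fun s : I => ((s : ℝ) - t)⁻¹ * (φ (F s) - φ (F t))) (𝓝[≠] t) (𝓝 (φ v)) := by
    have := (φ.continuous.tendsto v).comp h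
    refine this.congr fun s => ?_
    simp
  have h2 : Tendsto (projIcc 0 1 zero_le_one : ℝ → I) (𝓝[≠] (t : ℝ)) (𝓝[≠] t) := by
    refine tendsto_nhdsWithin_of_tendsto_nhds_of_eventually_within _ ?_ ?_
    · have := (continuous_projIcc (h := (zero_le_one : (0 : ℝ) ≤ 1))).tendsto (t : ℝ)
      rw [projIcc_val] at this
      exact this.mono_left nhdsWithin_le_nhds
    · filter_upwards [self_mem_nhdsWithin,
        eventually_nhdsWithin_of_eventually_nhds (Ioo_mem_nhds ht.1 ht.2)] with u hu hu' he
      apply hu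
      rw [projIcc_of_mem zero_le_one (Ioo_subset_Icc_self hu')] at he
      exact congrArg Subtype.val he
  refine (h1.comp h2).congr' ?_
  filter_upwards [eventually_nhdsWithin_of_eventually_nhds (Ioo_mem_nhds ht.1 ht.2)] with u hu
  have hu' := Ioo_subset_Icc_self hu
  rw [Function.comp, projIcc_of_mem zero_le_one hu', slope_def_field, unitExt_of_mem F hu',
    unitExt_coe, div_eq_inv_mul]

variable [IsTopologicalAddGroup E] [ContinuousSMul ℝ E] [LocallyConvexSpace ℝ E]

theorem IsSeminormLipschitz.continuous {f : I → E} (hf : IsSeminormLipschitz f) :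
    Continuous f := by
  rw [continuous_iff_continuousAt]
  intro t
  rw [ContinuousAt, tendsto_nhds_iff_seminorm]
  intro p hp
  obtain ⟨L, -, hL⟩ := hf p hp
  refine squeeze_zero (fun _ => apply_nonneg _ _) (fun s => hL s t) ?_
  have : Continuous fun s : I => L * |(s : ℝ) - t| := by fun_prop
  simpa using this.tendsto t

theorem IsSeminormLipschitz.isLipschitzCurve {f : I → E} (hf : IsSeminormLipschitz f) :
    IsLipschitzCurve f := by
  rw [IsLipschitzCurve, (PolynormableSpace.withSeminorms ℝ E).isVonNBounded_iff_seminorm_bounded]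
  rintro ⟨p, hp⟩
  obtain ⟨L, h0, hL⟩ := hf p hp
  refine ⟨L + 1, by positivity, ?_⟩
  rintro x ⟨s, t, hst, rfl⟩
  have h1 : 0 < |(t : ℝ) - s| := abs_pos.2 (sub_ne_zero.2 fun h => hst (Subtype.ext h).symm)
  rw [map_smul_eq_mul, Real.norm_eq_abs, abs_inv, inv_mul_lt_iff₀ h1]
  nlinarith [hL t s]

/-- The Riemann integral is a weak integral: functionals commute with Riemann sums, and the
equidistant sums of the Lipschitz function `φ ∘ f` converge to its integral with error at most `L /
n`. -/
theorem IsMackeyComplete.hasLipschitzIntegrals (hE : IsMackeyComplete E) :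
    HasLipschitzIntegrals E := by
  intro f hf
  obtain ⟨v, hv⟩ := hE f hf.isLipschitzCurve
  refine ⟨v, fun φ => ?_⟩
  obtain ⟨L, h0, hL⟩ := hf.dual φ
  have hc : Continuous fun u => φ (unitExt f u) := φ.continuous.comp hf.continuous.unitExt
  refine eq_of_abs_sub_le_all fun ε hε => ?_
  obtain ⟨δ, hδ, H⟩ := hv {w | |φ w - φ v| < ε / 2} (by
    have : Continuous fun w => |φ w - φ v| := by fun_prop
    exact this.continuousAt.eventually_lt continuousAt_const (by simpa using hε))
  -- The mesh `1 / n` must be below `δ`, and the scalar error `L / n` at most `ε / 2`.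
  obtain ⟨n, hn⟩ := exists_nat_gt (max (1 / δ) (2 * L / ε))
  have hn' : (0 : ℝ) < n := lt_of_le_of_lt (le_max_of_le_left (by positivity)) hn
  have hnd : 1 / (n : ℝ) < δ := by
    rw [one_div_lt hn' hδ]; exact (le_max_left _ _).trans_lt hn
  have hnL : L / n ≤ ε / 2 := by
    have := (le_max_right _ _).trans_lt hn
    rw [div_lt_iff₀ hε] at this
    rw [div_le_iff₀ hn']
    linarith
  set x : ℕ → I := fun i => projIcc 0 1 zero_le_one ((i : ℝ) / n) with hx
  have hxv : ∀ i ≤ n, (x i : ℝ) = i / n := fun i hi => by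
    have hi' : (i : ℝ) ≤ n := by exact_mod_cast hi
    rw [hx]
    simp only
    rw [projIcc_of_mem zero_le_one ⟨by positivity, (div_le_one hn').2 hi'⟩]
  have hmono : Monotone x := by
    intro i j hij
    apply monotone_projIcc
    have : (i : ℝ) ≤ j := by exact_mod_cast hij
    gcongr
  have hstep : ∀ i < n, (x (i + 1) : ℝ) - x i = (n : ℝ)⁻¹ := fun i hi => by
    rw [hxv _ hi, hxv _ hi.le]; push_cast; field_simp; ring
  have h1 := H n x x hmono (Subtype.ext (by rw [hxv 0 (Nat.zero_le _)]; simp))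
    (Subtype.ext (by rw [hxv n le_rfl]; simp [hn'.ne'])) (fun i _ => ⟨le_rfl, hmono i.le_succ⟩)
    (fun i hi => by rw [hstep i hi, ← one_div]; exact hnd)
  have h2 := abs_riemannSum_sub_integral_le hc (L := L) (fun s hs t ht => by
    rw [unitExt_of_mem f hs, unitExt_of_mem f ht]; exact hL _ _) (Nat.cast_pos.1 hn')
  have h3 : φ (∑ i ∈ Finset.range n, ((x (i + 1) : ℝ) - x i) • f (x i)) =
      ∑ i ∈ Finset.range n, (n : ℝ)⁻¹ * φ (unitExt f (i / n)) := by
    rw [map_sum]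
    refine Finset.sum_congr rfl fun i hi => ?_
    have hi := Finset.mem_range.1 hi
    rw [hstep i hi, map_smul, smul_eq_mul, ← hxv i hi.le, unitExt_coe]
  simp only [mem_ofPred_eq, h3] at h1
  rw [abs_le] at h2 ⊢
  rw [abs_lt] at h1
  constructor <;> linarith [h1.1, h1.2, h2.1, h2.2]

omit [IsTopologicalAddGroup E] [ContinuousSMul ℝ E] [LocallyConvexSpace ℝ E] in
-- Integrals are available over `[0,1]` only, so the integral of `f` over `[0,t]` is obtained as
-- that of the rescaled curve `s ↦ t f(ts)`, which is Lipschitz with the same constants as `f`.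
theorem HasLipschitzIntegrals.exists_primitive (hE : HasLipschitzIntegrals E) {f : I → E}
    (hf : IsSeminormLipschitz f) (e : E) : ∃ F : I → E, F 0 = e ∧ IsWeakPrimitive F f := by
  have h1 : ∀ t : I, IsSeminormLipschitz fun s : I => (t : ℝ) • f (t * s) := fun t p hp => by
    obtain ⟨L, h0, hL⟩ := hf p hp
    refine ⟨L, h0, fun r s => ?_⟩
    rw [← smul_sub, map_smul_eq_mul, Real.norm_eq_abs, abs_of_nonneg t.2.1]
    refine (mul_le_of_le_one_left (apply_nonneg _ _) t.2.2).trans ((hL _ _).trans ?_)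
    refine mul_le_mul_of_nonneg_left ?_ h0
    rw [Icc.coe_mul, Icc.coe_mul, ← mul_sub, abs_mul, abs_of_nonneg t.2.1]
    exact mul_le_of_le_one_left (abs_nonneg _) t.2.2
  choose V hV using fun t => hE _ (h1 t)
  refine ⟨fun t => e + V t - V 0, by simp, fun φ t => ?_⟩
  have h2 : ∀ t : I, φ (V t) = ∫ u in (0 : ℝ)..t, φ (unitExt f u) := fun t => by
    have h3 : ∫ u in (0 : ℝ)..1, φ (unitExt (fun s : I => (t : ℝ) • f (t * s)) u) =
        ∫ u in (0 : ℝ)..1, (t : ℝ) • φ (unitExt f (t * u)) := by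
      refine intervalIntegral.integral_congr fun u hu => ?_
      rw [uIcc_of_le zero_le_one] at hu
      have hm : (t : ℝ) * u ∈ Icc (0 : ℝ) 1 := (t * ⟨u, hu⟩ : I).2
      rw [unitExt_of_mem _ hu, unitExt_of_mem _ hm, map_smul]
      rfl
    rw [hV t φ, h3, intervalIntegral.integral_smul,
      intervalIntegral.smul_integral_comp_mul_left (f := fun u => φ (unitExt f u))]
    simp
  simp only [map_sub, map_add, h2]
  simp

theorem IsWeakPrimitive.seminorm_sub_le {F f : I → E} (h : IsWeakPrimitive F f)
    (hf : Continuous f) {p : Seminorm ℝ E} (hp : Continuous p) {s t : I} (hst : s ≤ t) :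
    p (F t - F s) ≤ ∫ u in (s : ℝ)..t, p (unitExt f u) := by
  refine Seminorm.le_of_forall_dual hp fun φ hφ => ?_
  rw [map_sub, h.sub_eq hf]
  refine intervalIntegral.integral_mono_on hst
    ((φ.continuous.comp hf.unitExt).intervalIntegrable _ _)
    ((hp.comp hf.unitExt).intervalIntegrable _ _) fun u _ => (le_abs_self _).trans (hφ _)

theorem IsWeakPrimitive.seminorm_sub_le_mul {F f : I → E} (h : IsWeakPrimitive F f)
    (hf : Continuous f) {p : Seminorm ℝ E} (hp : Continuous p) {C : ℝ} (hC : ∀ t, p (f t) ≤ C)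
    (s t : I) : p (F s - F t) ≤ C * |(s : ℝ) - t| := by
  wlog hst : t ≤ s generalizing s t
  · rw [map_sub_rev, abs_sub_comm]
    exact this t s (le_of_not_ge hst)
  refine (h.seminorm_sub_le hf hp hst).trans ?_
  have hst' : (t : ℝ) ≤ s := hst
  rw [abs_of_nonneg (sub_nonneg.2 hst')]
  have : C * ((s : ℝ) - t) = ∫ _u in (t : ℝ)..s, C := by simp [mul_comm]
  rw [this]
  refine intervalIntegral.integral_mono_on hst
    ((hp.comp hf.unitExt).intervalIntegrable _ _) (by simp) fun u _ => hC _

theorem IsWeakPrimitive.isSeminormLipschitz {F f : I → E} (h : IsWeakPrimitive F f)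
    (hf : Continuous f) : IsSeminormLipschitz F := fun p hp => by
  obtain ⟨C, hC0, hC⟩ := hf.exists_seminorm_bound hp
  exact ⟨C, hC0.le, h.seminorm_sub_le_mul hf hp hC⟩

/-- The fundamental theorem of calculus: the scalar estimates are uniform over all functionals
dominated by `p`, so the weak identity yields a derivative in the original topology. -/
theorem IsWeakPrimitive.hasCurveDerivAt {F f : I → E} (h : IsWeakPrimitive F f)
    (hf : Continuous f) (t : I) : HasCurveDerivAt F (f t) t := by
  rw [HasCurveDerivAt, tendsto_nhds_iff_seminorm]
  intro p hp
  rw [Metric.tendsto_nhds]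
  intro ε hε
  have h1 : ∀ᶠ s in 𝓝 t, p (f s - f t) < ε / 2 := by
    have : Continuous fun s => p (f s - f t) := hp.comp (hf.sub continuous_const)
    exact this.continuousAt.eventually_lt continuousAt_const (by simpa using hε)
  obtain ⟨δ, hδ, H⟩ := Metric.eventually_nhds_iff.1 h1
  have h2 : ∀ᶠ s in 𝓝[≠] t, dist s t < δ :=
    eventually_nhdsWithin_of_eventually_nhds (Metric.ball_mem_nhds t hδ)
  filter_upwards [h2, self_mem_nhdsWithin] with s hs hne
  have hne' : ((s : ℝ) - t) ≠ 0 := sub_ne_zero.2 fun h => hne (Subtype.ext h)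
  rw [Real.dist_eq, sub_zero, abs_of_nonneg (apply_nonneg _ _)]
  refine lt_of_le_of_lt ?_ (half_lt_self hε)
  refine Seminorm.le_of_forall_dual hp fun φ hφ => ?_
  have hc : Continuous fun u => φ (unitExt f u) := φ.continuous.comp hf.unitExt
  have h3 : φ (((s : ℝ) - t)⁻¹ • (F s - F t) - f t) =
      ((s : ℝ) - t)⁻¹ * ∫ u in (t : ℝ)..s, (φ (unitExt f u) - φ (f t)) := by
    rw [intervalIntegral.integral_sub (hc.intervalIntegrable _ _) (by simp),
      intervalIntegral.integral_const, ← h.sub_eq hf, map_sub, map_smul, map_sub, smul_eq_mul,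
      smul_eq_mul, mul_sub _ (_ - _), ← mul_assoc, inv_mul_cancel₀ hne', one_mul]
  have h4 := intervalIntegral.norm_integral_le_of_norm_le_const
    (f := fun u => φ (unitExt f u) - φ (f t)) (a := (t : ℝ)) (b := s) (C := ε / 2) ?_
  · rw [h3]
    refine (le_abs_self _).trans ?_
    rw [abs_mul, abs_inv, inv_mul_le_iff₀ (abs_pos.2 hne'), mul_comm]
    exact h4
  · intro u hu
    have hu' : u ∈ Icc (0 : ℝ) 1 :=
      (uIcc_subset_Icc t.2 s.2) (uIoc_subset_uIcc hu)
    have hd : dist (⟨u, hu'⟩ : I) t < δ := by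
      refine lt_of_le_of_lt ?_ hs
      rw [Subtype.dist_eq, Subtype.dist_eq, Real.dist_eq, Real.dist_eq]
      have := abs_sub_left_of_mem_uIcc (uIoc_subset_uIcc hu)
      simpa using this
    rw [unitExt_of_mem _ hu', Real.norm_eq_abs, ← map_sub]
    exact (hφ _).trans (H hd).le

omit [IsTopologicalAddGroup E] [ContinuousSMul ℝ E] [LocallyConvexSpace ℝ E] in
theorem IsWeakPrimitive.of_hasCurveDerivAt {F f : I → E} (hF : Continuous F)
    (hf : Continuous f) (h : ∀ t, HasCurveDerivAt F (f t) t) : IsWeakPrimitive F f := by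
  intro φ t
  rw [intervalIntegral.integral_eq_sub_of_hasDerivAt_of_le (f := fun u => φ (unitExt F u))
    (f' := fun u => φ (unitExt f u)) t.2.1
    (φ.continuous.comp hF.unitExt).continuousOn ?_
    (Continuous.intervalIntegrable (φ.continuous.comp hf.unitExt) _ _), unitExt_coe]
  · have : unitExt F 0 = F 0 := unitExt_coe F 0
    rw [this]
  · intro u hu
    have hu' : u ∈ Ioo (0 : ℝ) 1 := ⟨hu.1, hu.2.trans_le t.2.2⟩
    rw [unitExt_of_mem f (Ioo_subset_Icc_self hu')]
    exact hasDerivAt_of_hasCurveDerivAt (h ⟨u, Ioo_subset_Icc_self hu'⟩) hu' φ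

end Curves

/-! ### Sums of rapidly decreasing series as integrals of Lipschitz curves -/

section WeakSums

/-- A bump function supported on `[0, a⁻¹]`. -/
def parabolicBump (a s : ℝ) : ℝ := max 0 (s - a * s ^ 2)

theorem continuous_parabolicBump (a : ℝ) : Continuous (parabolicBump a) := by
  unfold parabolicBump; fun_prop

theorem parabolicBump_nonneg (a s : ℝ) : 0 ≤ parabolicBump a s := le_max_left _ _

theorem parabolicBump_eq_of_le {a s : ℝ} (ha : 0 < a) (hs : 0 ≤ s) (h : s ≤ a⁻¹) :
    parabolicBump a s = s - a * s ^ 2 := by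
  refine max_eq_right ?_
  have : a * s ≤ 1 := by
    have := mul_le_mul_of_nonneg_left h ha.le
    rwa [mul_inv_cancel₀ ha.ne'] at this
  nlinarith

theorem parabolicBump_eq_zero {a s : ℝ} (ha : 0 < a) (hs : 0 ≤ s) (h : a⁻¹ ≤ s) :
    parabolicBump a s = 0 := by
  refine max_eq_left ?_
  have : 1 ≤ a * s := by
    have := mul_le_mul_of_nonneg_left h ha.le
    rwa [mul_inv_cancel₀ ha.ne'] at this
  nlinarith

theorem parabolicBump_le_one {a s : ℝ} (ha : 0 ≤ a) (hs : s ≤ 1) : parabolicBump a s ≤ 1 :=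
  max_le zero_le_one (by nlinarith [mul_nonneg ha (sq_nonneg s)])

/-- On `[0, ∞)` the bump is `r ↦ r - a r²` evaluated at `min r a⁻¹`. A difference of such values
factors as `(x - y) (1 - (a x + a y))` with `a x` and `a y` in `[0,1]`, so the Lipschitz constant is
`1`, independently of `a`. -/
theorem abs_parabolicBump_sub_le {a s t : ℝ} (ha : 0 < a) (hs : 0 ≤ s) (ht : 0 ≤ t) :
    |parabolicBump a s - parabolicBump a t| ≤ |s - t| := by
  have key : ∀ r : ℝ, 0 ≤ r → parabolicBump a r =
      min r a⁻¹ - a * (min r a⁻¹) ^ 2 := fun r hr => by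
    rcases le_total r a⁻¹ with h | h
    · rw [parabolicBump_eq_of_le ha hr h, min_eq_left h]
    · rw [parabolicBump_eq_zero ha hr h, min_eq_right h]
      field_simp; ring
  rw [key s hs, key t ht]
  refine le_trans ?_ ((abs_min_sub_min_le_max s a⁻¹ t a⁻¹).trans (by simp))
  have h1 : ∀ r : ℝ, 0 ≤ r → 0 ≤ a * min r a⁻¹ ∧ a * min r a⁻¹ ≤ 1 := fun r hr => by
    constructor
    · have : 0 ≤ min r a⁻¹ := le_min hr (by positivity)
      positivity
    · have := mul_le_mul_of_nonneg_left (min_le_right r a⁻¹) ha.le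
      rwa [mul_inv_cancel₀ ha.ne'] at this
  obtain ⟨h2, h3⟩ := h1 s hs
  obtain ⟨h4, h5⟩ := h1 t ht
  have : min s a⁻¹ - a * min s a⁻¹ ^ 2 - (min t a⁻¹ - a * min t a⁻¹ ^ 2) =
      (min s a⁻¹ - min t a⁻¹) * (1 - (a * min s a⁻¹ + a * min t a⁻¹)) := by ring
  rw [this, abs_mul]
  refine mul_le_of_le_one_right (abs_nonneg _) ?_
  rw [abs_le]
  constructor <;> linarith

theorem integral_parabolicBump {a : ℝ} (ha : 1 ≤ a) :
    ∫ u in (0 : ℝ)..1, parabolicBump a u = (6 * a ^ 2)⁻¹ := by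
  have ha' : 0 < a := by linarith
  have hi : a⁻¹ ≤ 1 := inv_le_one_of_one_le₀ ha
  have hi0 : 0 ≤ a⁻¹ := by positivity
  have hc := continuous_parabolicBump a
  rw [← intervalIntegral.integral_add_adjacent_intervals (hc.intervalIntegrable 0 a⁻¹)
    (hc.intervalIntegrable a⁻¹ 1)]
  have h1 : ∫ u in (0 : ℝ)..a⁻¹, parabolicBump a u = ∫ u in (0 : ℝ)..a⁻¹, (u - a * u ^ 2) := by
    refine intervalIntegral.integral_congr fun u hu => ?_
    rw [uIcc_of_le hi0] at hu
    exact parabolicBump_eq_of_le ha' hu.1 hu.2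
  have h2 : ∫ u in a⁻¹..1, parabolicBump a u = ∫ u in a⁻¹..1, (0 : ℝ) := by
    refine intervalIntegral.integral_congr fun u hu => ?_
    rw [uIcc_of_le hi] at hu
    exact parabolicBump_eq_zero ha' (hi0.trans hu.1) hu.1
  rw [h1, h2, intervalIntegral.integral_sub (by simp) (by
    apply Continuous.intervalIntegrable; fun_prop), intervalIntegral.integral_const_mul,
    integral_pow, integral_id]
  simp
  field_simp
  norm_num

variable {E : Type*} [AddCommGroup E] [Module ℝ E] [TopologicalSpace E]
  [IsTopologicalAddGroup E] [ContinuousSMul ℝ E] [LocallyConvexSpace ℝ E]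

/-- Rapidly converging series have a sum in the weak topology. -/
theorem HasLipschitzIntegrals.exists_weak_sum (hE : HasLipschitzIntegrals E) {v : ℕ → E}
    (hv : ∀ p : Seminorm ℝ E, Continuous p → Summable fun n => (4 : ℝ) ^ n * p (v n)) :
    ∃ w, ∀ φ : E →L[ℝ] ℝ, HasSum (fun n => φ (v n)) (φ w) := by
  -- The factor is the reciprocal of the integral `1 / (6 * 4 ^ n)` of the bump with `a = 2 ^ n`;
  -- thus the bump times `w n` has integral `v n`.
  set w : ℕ → E := fun n => ((6 : ℝ) * 4 ^ n) • v n with hw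
  have hpw : ∀ p : Seminorm ℝ E, Continuous p → Summable fun n => p (w n) := fun p hp => by
    refine ((hv p hp).mul_left 6).congr fun n => ?_
    rw [hw, map_smul_eq_mul, Real.norm_eq_abs, abs_of_pos (by positivity), mul_assoc]
  -- At each `s > 0` the bumps with `2 ^ n ≥ s⁻¹` vanish, and `n ≥ s⁻¹` suffices for this. The sum
  -- is therefore finite and needs no completeness. At `s = 0` all bumps vanish, and the convention
  -- `0⁻¹ = 0` makes the sum empty.
  set c : I → E := fun s =>
    ∑ n ∈ Finset.range ⌈(s : ℝ)⁻¹⌉₊, parabolicBump (2 ^ n) s • w n with hcdef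
  have hc : ∀ (φ : E →L[ℝ] ℝ) (s : I),
      HasSum (fun n => parabolicBump (2 ^ n) s * φ (w n)) (φ (c s)) := by
    intro φ s
    have h1 : φ (c s) = ∑ n ∈ Finset.range ⌈(s : ℝ)⁻¹⌉₊, parabolicBump (2 ^ n) s * φ (w n) := by
      simp [hcdef, map_sum]
    rw [h1]
    refine hasSum_sum_of_ne_finset_zero fun n hn => ?_
    rw [Finset.mem_range, not_lt, Nat.ceil_le] at hn
    rcases s.2.1.eq_or_lt with h0 | h0
    · simp [parabolicBump, ← h0]
    · rw [parabolicBump_eq_zero (by positivity) s.2.1, zero_mul]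
      rw [inv_le_comm₀ (by positivity) h0]
      refine hn.trans ?_
      exact_mod_cast (Nat.lt_two_pow_self (n := n)).le
  have hlip : IsSeminormLipschitz c := by
    intro p hp
    -- Since every bump is 1-Lipschitz, the seminorms of the coefficients `w n` add up to a
    -- Lipschitz constant.
    refine ⟨∑' n, p (w n), tsum_nonneg fun _ => apply_nonneg _ _, fun s t => ?_⟩
    refine Seminorm.le_of_forall_dual hp fun φ hφ => ?_
    rw [map_sub]
    refine hasSum_le (fun n => ?_) ((hc φ s).sub (hc φ t))
      ((hpw p hp).hasSum.mul_right |(s : ℝ) - t|)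
    rw [← sub_mul, mul_comm]
    refine (le_abs_self _).trans ?_
    rw [abs_mul]
    exact mul_le_mul (hφ _) (abs_parabolicBump_sub_le (by positivity) s.2.1 t.2.1)
      (abs_nonneg _) (apply_nonneg _ _)
  obtain ⟨x, hx⟩ := hE c hlip
  refine ⟨x, fun φ => ?_⟩
  have hsum : Summable fun n => |φ (w n)| := by
    simpa using hpw _ (Seminorm.continuous_absComp φ)
  have h1 := intervalIntegral.hasSum_integral_of_dominated_convergence (a := 0) (b := 1)
    (μ := MeasureTheory.volume) (F := fun n u => parabolicBump (2 ^ n) u * φ (w n))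
    (f := fun u => φ (unitExt c u)) (fun n _ => |φ (w n)|)
    (fun n => ((continuous_parabolicBump _).mul continuous_const).aestronglyMeasurable)
    (fun n => Eventually.of_forall fun u hu => by
      rw [uIoc_of_le zero_le_one] at hu
      rw [Real.norm_eq_abs, abs_mul, abs_of_nonneg (parabolicBump_nonneg _ _)]
      exact mul_le_of_le_one_left (abs_nonneg _) (parabolicBump_le_one (by positivity) hu.2))
    (Eventually.of_forall fun u _ => hsum) (by simp)
    (Eventually.of_forall fun u hu => by
      rw [uIoc_of_le zero_le_one] at hu
      have := hc φ ⟨u, hu.1.le, hu.2⟩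
      rwa [← unitExt_of_mem c ⟨hu.1.le, hu.2⟩] at this)
  rw [hx φ]
  refine h1.congr_fun ?_
  intro n
  rw [intervalIntegral.integral_mul_const, integral_parabolicBump (one_le_pow₀ one_le_two), hw,
    map_smul, smul_eq_mul, ← mul_assoc, ← pow_mul, mul_comm n 2, pow_mul]
  norm_num
  field_simp

end WeakSums

/-! ### Picard iteration for linear differential equations -/

section Bilinear

variable {E : Type*} [AddCommGroup E] [Module ℝ E] [TopologicalSpace E]

/-- A bilinear map is locally submultiplicative if the topology is defined by seminorms which are
submultiplicative with respect to it. -/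
def IsLocallySubmultiplicative (m : E →ₗ[ℝ] E →ₗ[ℝ] E) : Prop :=
  ∀ q : Seminorm ℝ E, Continuous q →
    ∃ p : Seminorm ℝ E, Continuous p ∧ q ≤ p ∧ ∀ x y, p (m x y) ≤ p x * p y

/-- `η` solves the initial value problem `η' = m η γ`, `η 0 = e` in the weak sense. -/
structure IsSolution (m : E →ₗ[ℝ] E →ₗ[ℝ] E) (e : E) (γ η : I → E) : Prop where
  continuous : Continuous η
  map_zero : η 0 = e
  isWeakPrimitive : IsWeakPrimitive η fun t => m (η t) (γ t)

theorem IsSeminormLipschitz.const (e : E) : IsSeminormLipschitz fun _ => e :=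
  fun p _ => ⟨0, le_rfl, fun s t => by simp⟩

variable [IsTopologicalAddGroup E] [ContinuousSMul ℝ E] [LocallyConvexSpace ℝ E]
  {m : E →ₗ[ℝ] E →ₗ[ℝ] E}

theorem IsLocallySubmultiplicative.continuous (hm : IsLocallySubmultiplicative m) :
    Continuous fun z : E × E => m z.1 z.2 := by
  rw [continuous_iff_continuousAt]
  intro z
  rw [ContinuousAt, tendsto_nhds_iff_seminorm]
  intro q hq
  obtain ⟨p, hp, hqp, hpm⟩ := hm q hq
  have h1 : ∀ x : E × E, q (m x.1 x.2 - m z.1 z.2) ≤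
      p (x.1 - z.1) * p x.2 + p z.1 * p (x.2 - z.2) := fun x => by
    have h2 : m x.1 x.2 - m z.1 z.2 = m (x.1 - z.1) x.2 + m z.1 (x.2 - z.2) := by
      simp only [map_sub, LinearMap.sub_apply]; abel
    rw [h2]
    exact (hqp _).trans ((map_add_le_add p _ _).trans (add_le_add (hpm _ _) (hpm _ _)))
  refine squeeze_zero (fun _ => apply_nonneg _ _) h1 ?_
  have h3 : Continuous fun x : E × E => p (x.1 - z.1) * p x.2 + p z.1 * p (x.2 - z.2) := by
    fun_prop
  simpa using h3.tendsto z

theorem IsLocallySubmultiplicative.comp_continuous (hm : IsLocallySubmultiplicative m)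
    {X : Type*} [TopologicalSpace X] {f g : X → E} (hf : Continuous f) (hg : Continuous g) :
    Continuous fun t => m (f t) (g t) :=
  hm.continuous.comp (hf.prodMk hg)

theorem IsSeminormLipschitz.bilinear (hm : IsLocallySubmultiplicative m) {f g : I → E}
    (hf : IsSeminormLipschitz f) (hg : IsSeminormLipschitz g) :
    IsSeminormLipschitz fun t => m (f t) (g t) := by
  intro q hq
  obtain ⟨p, hp, hqp, hpm⟩ := hm q hq
  obtain ⟨L, hL0, hL⟩ := hf p hp
  obtain ⟨L', hL0', hL'⟩ := hg p hp
  obtain ⟨C, hC0, hC⟩ := hf.continuous.exists_seminorm_bound hp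
  obtain ⟨C', hC0', hC'⟩ := hg.continuous.exists_seminorm_bound hp
  refine ⟨L * C' + C * L', by positivity, fun s t => ?_⟩
  have h2 : m (f s) (g s) - m (f t) (g t) = m (f s - f t) (g s) + m (f t) (g s - g t) := by
    simp only [map_sub, LinearMap.sub_apply]; abel
  rw [h2]
  refine (hqp _).trans ((map_add_le_add p _ _).trans
    ((add_le_add (hpm _ _) (hpm _ _)).trans ?_))
  have h3 := mul_le_mul (hL s t) (hC' s) (apply_nonneg _ _) (by positivity)
  have h4 := mul_le_mul (hC t) (hL' s t) (apply_nonneg _ _) hC0.le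
  linarith

/-- The `η n` are the individual terms of the Picard series, not its partial sums. Every term stays
Lipschitz, which keeps the next integrand integrable. -/
theorem HasLipschitzIntegrals.exists_picard (hE : HasLipschitzIntegrals E)
    (hm : IsLocallySubmultiplicative m) (e : E) {γ : I → E} (hγ : IsSeminormLipschitz γ) :
    ∃ η : ℕ → I → E, (∀ n, IsSeminormLipschitz (η n)) ∧ (∀ t, η 0 t = e) ∧
      (∀ n, η (n + 1) 0 = 0) ∧ ∀ n, IsWeakPrimitive (η (n + 1)) fun t => m (η n t) (γ t) := by
  have step : ∀ f : {f : I → E // IsSeminormLipschitz f},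
      ∃ F : {f : I → E // IsSeminormLipschitz f}, F.1 0 = 0 ∧
        IsWeakPrimitive F.1 fun t => m (f.1 t) (γ t) := fun f => by
    obtain ⟨F, h0, hF⟩ := hE.exists_primitive (f.2.bilinear hm hγ) 0
    exact ⟨⟨F, hF.isSeminormLipschitz (f.2.bilinear hm hγ).continuous⟩, h0, hF⟩
  choose next h0 hnext using step
  let η : ℕ → {f : I → E // IsSeminormLipschitz f} := fun n =>
    Nat.rec ⟨fun _ => e, .const e⟩ (fun _ f => next f) n
  exact ⟨fun n => (η n).1, fun n => (η n).2, fun t => rfl, fun n => h0 (η n),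
    fun n => hnext (η n)⟩

theorem seminorm_picard_le (hm : IsLocallySubmultiplicative m) {γ : I → E} (hγ : Continuous γ)
    {e : E} {η : ℕ → I → E} (hη : ∀ n, Continuous (η n)) (h0 : ∀ t, η 0 t = e)
    (h0' : ∀ n, η (n + 1) 0 = 0)
    (h : ∀ n, IsWeakPrimitive (η (n + 1)) fun t => m (η n t) (γ t))
    {p : Seminorm ℝ E} (hp : Continuous p) (hpm : ∀ x y, p (m x y) ≤ p x * p y) {K : ℝ}
    (hK : ∀ t, p (γ t) ≤ K) (n : ℕ) (t : I) :
    p (η n t) ≤ p e * ((K * t) ^ n / n.factorial) := by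
  have hK0 : 0 ≤ K := (apply_nonneg _ _).trans (hK 0)
  induction n generalizing t with
  | zero => simp [h0]
  | succ n ih =>
    have hc := hm.comp_continuous (hη n) hγ
    have h1 := (h n).seminorm_sub_le hc hp (s := 0) (t := t) t.2.1
    rw [h0', sub_zero] at h1
    refine h1.trans ?_
    have h2 : ∫ u in (0 : ℝ)..t, p e * ((K * u) ^ n / n.factorial) * K =
        p e * ((K * t) ^ (n + 1) / (n + 1).factorial) := by
      have : ∀ u : ℝ, p e * ((K * u) ^ n / n.factorial) * K =
          (p e * K ^ (n + 1) / n.factorial) * u ^ n := fun u => by ring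
      simp_rw [this]
      rw [intervalIntegral.integral_const_mul, integral_pow, Nat.factorial_succ]
      push_cast
      have := Nat.factorial_ne_zero n
      field_simp
      ring
    rw [← h2]
    refine intervalIntegral.integral_mono_on t.2.1 ((hp.comp hc.unitExt).intervalIntegrable _ _)
      (Continuous.intervalIntegrable (by fun_prop) _ _) fun u hu => ?_
    rw [unitExt_of_mem _ ⟨hu.1, hu.2.trans t.2.2⟩]
    exact (hpm _ _).trans (mul_le_mul (ih _) (hK _) (apply_nonneg _ _)
      (mul_nonneg (apply_nonneg _ _)
        (div_nonneg (pow_nonneg (mul_nonneg hK0 hu.1) _) (by positivity))))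

/-- The factorial decay of the Picard terms beats the weight `4 ^ n`, so the series has a weak sum
at each `t`. Lipschitz bounds for the terms are summable, which makes the sum continuous, and
dominated convergence gives the integral equation. -/
theorem HasLipschitzIntegrals.exists_isSolution [T2Space E] (hE : HasLipschitzIntegrals E)
    (hm : IsLocallySubmultiplicative m) (e : E) {γ : I → E} (hγ : IsSeminormLipschitz γ) :
    ∃ η, IsSolution m e γ η := by
  obtain ⟨η, hη, h0, h0', h⟩ := hE.exists_picard hm e hγ
  have hηc := fun n => (hη n).continuous
  have bound : ∀ p : Seminorm ℝ E, Continuous p → (∀ x y, p (m x y) ≤ p x * p y) →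
      ∃ K, 0 ≤ K ∧ (∀ t, p (γ t) ≤ K) ∧ ∀ n t, p (η n t) ≤ p e * (K ^ n / n.factorial) := by
    intro p hp hpm
    obtain ⟨K, hK0, hK⟩ := hγ.continuous.exists_seminorm_bound hp
    refine ⟨K, hK0.le, hK, fun n t => (seminorm_picard_le hm hγ.continuous hηc h0 h0' h hp hpm hK
      n t).trans ?_⟩
    refine mul_le_mul_of_nonneg_left ?_ (apply_nonneg _ _)
    refine div_le_div_of_nonneg_right ?_ (by positivity)
    exact pow_le_pow_left₀ (mul_nonneg hK0.le t.2.1) (mul_le_of_le_one_right hK0.le t.2.2) n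
  have hsum : ∀ t, ∀ q : Seminorm ℝ E, Continuous q →
      Summable fun n => (4 : ℝ) ^ n * q (η n t) := by
    intro t q hq
    obtain ⟨p, hp, hqp, hpm⟩ := hm q hq
    obtain ⟨K, hK0, hK, hb⟩ := bound p hp hpm
    refine Summable.of_nonneg_of_le (fun n => by positivity) (fun n => ?_)
      ((Real.summable_pow_div_factorial (4 * K)).mul_left (p e))
    rw [mul_pow, mul_div_assoc, mul_left_comm]
    exact mul_le_mul_of_nonneg_left ((hqp _).trans (hb n t)) (by positivity)
  choose S hS using fun t => hE.exists_weak_sum (hsum t)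
  have hSlip : IsSeminormLipschitz S := by
    intro q hq
    obtain ⟨p, hp, hqp, hpm⟩ := hm q hq
    obtain ⟨K, hK0, hK, hb⟩ := bound p hp hpm
    have hs := ((Real.summable_pow_div_factorial K).mul_left (p e)).mul_right K
    refine ⟨∑' n : ℕ, p e * (K ^ n / n.factorial) * K, tsum_nonneg fun n => by positivity,
      fun s t => (hqp _).trans ?_⟩
    refine Seminorm.le_of_forall_dual hp fun φ hφ => ?_
    rw [map_sub]
    have h1 := (hS s φ).sub (hS t φ)
    -- The constant term `η 0` cancels in the difference; the remaining terms are primitives, each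
    -- with its own Lipschitz bound.
    rw [← hasSum_nat_add_iff' 1] at h1
    simp only [Finset.range_one, Finset.sum_singleton, h0, sub_self, sub_zero] at h1
    refine hasSum_le (fun n => ?_) h1 (hs.hasSum.mul_right |(s : ℝ) - t|)
    rw [← map_sub]
    refine (le_abs_self _).trans ((hφ _).trans ?_)
    refine (h n).seminorm_sub_le_mul (hm.comp_continuous (hηc n) hγ.continuous) hp
      (fun t => (hpm _ _).trans (mul_le_mul (hb n t) (hK t) (apply_nonneg _ _) (by positivity))) s t
  refine ⟨S, hSlip.continuous, ?_, fun φ t => ?_⟩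
  · refine ContinuousLinearMap.eq_of_forall_dual fun φ => (hS 0 φ).unique ?_
    rw [← h0 0]
    refine hasSum_single 0 fun n hn => ?_
    obtain ⟨k, rfl⟩ := Nat.exists_eq_succ_of_ne_zero hn
    rw [Nat.succ_eq_add_one, h0', map_zero]
  · obtain ⟨p, hp, hqp, hpm⟩ := hm _ (Seminorm.continuous_absComp φ)
    obtain ⟨K, hK0, hK, hb⟩ := bound p hp hpm
    have hs := ((Real.summable_pow_div_factorial K).mul_left (p e)).mul_right K
    have h1 := (hS t φ).sub (hS 0 φ)
    rw [← hasSum_nat_add_iff' 1] at h1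
    simp only [Finset.range_one, Finset.sum_singleton, h0, sub_self, sub_zero] at h1
    refine h1.unique ?_
    simp only [h _ φ t]
    refine intervalIntegral.hasSum_integral_of_dominated_convergence
      (fun n _ => p e * (K ^ n / n.factorial) * K)
      (fun n => (φ.continuous.comp
        (hm.comp_continuous (hηc n) hγ.continuous).unitExt).aestronglyMeasurable)
      (fun n => Eventually.of_forall fun u _ => ?_) (Eventually.of_forall fun u _ => hs) (by simp)
      (Eventually.of_forall fun u _ => ?_)
    · obtain ⟨s, hs⟩ := exists_unitExt (fun t => m (η n t) (γ t)) u
      rw [hs]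
      exact (hqp _).trans ((hpm _ _).trans
        (mul_le_mul (hb n s) (hK s) (apply_nonneg _ _) (by positivity)))
    · let s : I := projIcc 0 1 zero_le_one u
      -- Right multiplication by `γ s` followed by `φ` is again a continuous functional, so weak
      -- summation already gives convergence of the integrands.
      have hcl : Continuous fun x => m x (γ s) := hm.comp_continuous continuous_id continuous_const
      exact hS s (φ.comp ⟨m.flip (γ s), hcl⟩)

end Bilinear

/-! ### Gronwall estimates, uniqueness and dependence on the driving curve -/

section Gronwall

variable {E F : Type*} [AddCommGroup E] [Module ℝ E] [TopologicalSpace E]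
  [AddCommGroup F] [Module ℝ F] [TopologicalSpace F]

theorem IsWeakPrimitive.sub {F G f g : I → E} (hF : IsWeakPrimitive F f)
    (hG : IsWeakPrimitive G g) (hf : Continuous f) (hg : Continuous g) :
    IsWeakPrimitive (fun t => F t - G t) fun t => f t - g t := fun φ t => by
  have h1 : ∀ u, φ (unitExt (fun t => f t - g t) u) = φ (unitExt f u) - φ (unitExt g u) :=
    fun u => map_sub φ _ _
  simp only [h1]
  rw [intervalIntegral.integral_sub (hf.intervalIntegrable_dual φ _ _)
    (hg.intervalIntegrable_dual φ _ _), ← hF φ t, ← hG φ t]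
  simp only [map_sub]
  ring

theorem IsWeakPrimitive.const_smul {F f : I → E} (hF : IsWeakPrimitive F f) (c : ℝ) :
    IsWeakPrimitive (fun t => c • F t) fun t => c • f t := fun φ t => by
  have h1 : ∀ u, φ (unitExt (fun t => c • f t) u) = c • φ (unitExt f u) := fun u => map_smul φ _ _
  simp only [h1]
  rw [intervalIntegral.integral_smul, ← hF φ t]
  simp only [map_smul, smul_eq_mul]
  ring

theorem IsWeakPrimitive.map {G g : I → E} (h : IsWeakPrimitive G g) (L : E →L[ℝ] F) :
    IsWeakPrimitive (fun t => L (G t)) fun t => L (g t) := fun φ t => h (φ.comp L) t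

theorem IsSeminormLipschitz.map {f : I → E} (hf : IsSeminormLipschitz f) (L : E →L[ℝ] F) :
    IsSeminormLipschitz fun t => L (f t) := fun p hp => by
  obtain ⟨C, hC0, hC⟩ := hf (p.comp L.toLinearMap) (hp.comp L.continuous)
  refine ⟨C, hC0, fun s t => ?_⟩
  rw [← map_sub]
  exact hC s t

theorem eq_zero_of_forall_seminorm [IsTopologicalAddGroup E] [ContinuousSMul ℝ E]
    [LocallyConvexSpace ℝ E] [T2Space E] {v : E}
    (h : ∀ p : Seminorm ℝ E, Continuous p → p v = 0) : v = 0 := by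
  refine ContinuousLinearMap.eq_of_forall_dual fun φ => ?_
  simpa using h _ (Seminorm.continuous_absComp φ)

variable [IsTopologicalAddGroup E] [ContinuousSMul ℝ E] [LocallyConvexSpace ℝ E]
  {m : E →ₗ[ℝ] E →ₗ[ℝ] E}

/-- The function `t ↦ p (X t)` need not be differentiable. It is majorized by `b t = ∫ (K p(X) +
δ)`, which is differentiable with `b' ≤ K b + δ`, and the scalar Gronwall inequality applies to `b`.
-/
theorem seminorm_le_of_isWeakPrimitive (hm : IsLocallySubmultiplicative m) {γ β X : I → E}
    (hγ : Continuous γ) (hβ : Continuous β) (hX : Continuous X) (h0 : X 0 = 0)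
    (h : IsWeakPrimitive X fun t => m (X t) (γ t) + β t)
    {p : Seminorm ℝ E} (hp : Continuous p) (hpm : ∀ x y, p (m x y) ≤ p x * p y) {K δ : ℝ}
    (hK1 : 1 ≤ K) (hK : ∀ t, p (γ t) ≤ K) (hδ : ∀ t, p (β t) ≤ δ) (t : I) :
    p (X t) ≤ δ * Real.exp K := by
  have hδ0 : 0 ≤ δ := (apply_nonneg _ _).trans (hδ 0)
  set g : ℝ → ℝ := fun u => K * p (unitExt X u) + δ with hg
  have hgc : Continuous g := by
    have := hp.comp hX.unitExt
    exact (continuous_const.mul this).add continuous_const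
  have hg0 : ∀ u, 0 ≤ g u := fun u => by
    have := apply_nonneg p (unitExt X u)
    positivity
  set b : ℝ → ℝ := fun t => ∫ u in (0 : ℝ)..t, g u with hb
  have hXb : ∀ t : I, p (X t) ≤ b t := fun t => by
    have hc := (hm.comp_continuous hX hγ).add hβ
    have h1 := h.seminorm_sub_le hc hp (s := 0) (t := t) t.2.1
    rw [h0, sub_zero] at h1
    refine h1.trans (intervalIntegral.integral_mono_on t.2.1
      ((hp.comp hc.unitExt).intervalIntegrable _ _) (hgc.intervalIntegrable _ _) fun u hu => ?_)
    have hu' : u ∈ Icc (0 : ℝ) 1 := ⟨hu.1, hu.2.trans t.2.2⟩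
    rw [hg, unitExt_of_mem _ hu']
    simp only
    rw [unitExt_of_mem _ hu']
    refine (map_add_le_add p _ _).trans (add_le_add ((hpm _ _).trans ?_) (hδ _))
    rw [mul_comm]
    exact mul_le_mul_of_nonneg_right (hK _) (apply_nonneg _ _)
  have hb0 : ∀ x, 0 ≤ x → 0 ≤ b x := fun x hx =>
    intervalIntegral.integral_nonneg hx fun u _ => hg0 u
  have h2 := norm_le_gronwallBound_of_norm_deriv_right_le (f := b) (f' := g) (δ := 0) (K := K)
    (ε := δ) (a := 0) (b := 1)
    (fun x _ => (hgc.integral_hasStrictDerivAt 0 x).hasDerivAt.continuousAt.continuousWithinAt)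
    (fun x _ => (hgc.integral_hasStrictDerivAt 0 x).hasDerivAt.hasDerivWithinAt)
    (by simp [hb]) (fun x hx => by
      have hx' : x ∈ Icc (0 : ℝ) 1 := Ico_subset_Icc_self hx
      rw [Real.norm_of_nonneg (hg0 x), Real.norm_of_nonneg (hb0 x hx.1), hg]
      simp only
      rw [unitExt_of_mem _ hx']
      have := mul_le_mul_of_nonneg_left (hXb ⟨x, hx'⟩) (by linarith : 0 ≤ K)
      linarith) t t.2
  rw [Real.norm_of_nonneg (hb0 t t.2.1), sub_zero,
    gronwallBound_of_K_ne_0 (by linarith : K ≠ 0)] at h2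
  refine (hXb t).trans (h2.trans ?_)
  simp only [zero_mul, zero_add]
  have h3 : Real.exp (K * t) ≤ Real.exp K :=
    Real.exp_le_exp.2 (mul_le_of_le_one_right (by linarith) t.2.2)
  -- The Gronwall bound is `(δ / K) (exp (K t) - 1)`; the normalization `1 ≤ K` removes the
  -- denominator.
  have h4 : δ / K ≤ δ := div_le_self hδ0 hK1
  have h5 : 0 ≤ Real.exp (K * t) - 1 := by
    rw [sub_nonneg, ← Real.exp_zero]
    exact Real.exp_le_exp.2 (mul_nonneg (by linarith) t.2.1)
  exact mul_le_mul h4 (by linarith) h5 hδ0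

/-- The difference `X = η - η'` of the two solutions satisfies the perturbed equation `X' = X γ + η'
(γ - γ')` with `X 0 = 0`. -/
theorem IsSolution.seminorm_sub_le (hm : IsLocallySubmultiplicative m) {e : E}
    {γ γ' η η' : I → E} (hγ : Continuous γ) (hγ' : Continuous γ') (h : IsSolution m e γ η)
    (h' : IsSolution m e γ' η')
    {p : Seminorm ℝ E} (hp : Continuous p) (hpm : ∀ x y, p (m x y) ≤ p x * p y) {K M δ : ℝ}
    (hK1 : 1 ≤ K) (hK : ∀ t, p (γ t) ≤ K) (hM : ∀ t, p (η' t) ≤ M)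
    (hδ : ∀ t, p (γ t - γ' t) ≤ δ) (t : I) :
    p (η t - η' t) ≤ M * δ * Real.exp K := by
  have hM0 : 0 ≤ M := (apply_nonneg _ _).trans (hM 0)
  refine seminorm_le_of_isWeakPrimitive hm hγ (β := fun t => m (η' t) (γ t - γ' t))
    (X := fun t => η t - η' t) (hm.comp_continuous h'.continuous (hγ.sub hγ'))
    (h.continuous.sub h'.continuous) (by rw [h.map_zero, h'.map_zero, sub_self]) ?_ hp hpm hK1 hK
    (fun t => (hpm _ _).trans (mul_le_mul (hM t) (hδ t) (apply_nonneg _ _) hM0)) t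
  convert h.isWeakPrimitive.sub h'.isWeakPrimitive (hm.comp_continuous h.continuous hγ)
    (hm.comp_continuous h'.continuous hγ') using 2 with t
  simp only [map_sub, LinearMap.sub_apply]
  abel

theorem IsSolution.unique [T2Space E] (hm : IsLocallySubmultiplicative m) {e : E}
    {γ η η' : I → E} (hγ : Continuous γ) (h : IsSolution m e γ η)
    (h' : IsSolution m e γ η') : η = η' := by
  funext t
  rw [← sub_eq_zero]
  refine eq_zero_of_forall_seminorm fun q hq => ?_
  obtain ⟨p, hp, hqp, hpm⟩ := hm q hq
  obtain ⟨K, hK0, hK⟩ := hγ.exists_seminorm_bound hp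
  obtain ⟨M, hM0, hM⟩ := h'.continuous.exists_seminorm_bound hp
  have h1 := h.seminorm_sub_le hm hγ hγ h' hp hpm (K := max 1 K) (δ := 0) (le_max_left _ _)
    (fun t => (hK t).trans (le_max_right _ _)) hM (fun t => by simp) t
  rw [mul_zero, zero_mul] at h1
  exact le_antisymm ((hqp _).trans h1) (apply_nonneg _ _)

end Gronwall

/-! ### Dual numbers and the derivative of the solution -/

section Tangent

variable {E : Type*} [AddCommGroup E] [Module ℝ E]

/-- The bilinear map `m` extended to dual numbers: `(x₁ + ε x₂, y₁ + ε y₂) ↦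
m x₁ y₁ + ε (m x₁ y₂ + m x₂ y₁)`. -/
def LinearMap.tangent (m : E →ₗ[ℝ] E →ₗ[ℝ] E) : E × E →ₗ[ℝ] E × E →ₗ[ℝ] E × E :=
  LinearMap.mk₂ ℝ (fun x y => (m x.1 y.1, m x.1 y.2 + m x.2 y.1))
    (fun x x' y => by
      ext <;> simp only [Prod.fst_add, Prod.snd_add, map_add, LinearMap.add_apply]; abel)
    (fun c x y => by
      ext <;> simp only [Prod.smul_fst, Prod.smul_snd, map_smul, LinearMap.smul_apply, smul_add])
    (fun x y y' => by ext <;> simp only [Prod.fst_add, Prod.snd_add, map_add]; abel)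
    (fun c x y => by ext <;> simp only [Prod.smul_fst, Prod.smul_snd, map_smul, smul_add])

variable [TopologicalSpace E]

/-- On dual numbers the ℓ¹-combination of a submultiplicative seminorm is submultiplicative:
expanding the product of sums produces all the required terms and the extra `p x.2 * p y.2`. -/
theorem IsLocallySubmultiplicative.tangent {m : E →ₗ[ℝ] E →ₗ[ℝ] E}
    (hm : IsLocallySubmultiplicative m) : IsLocallySubmultiplicative m.tangent := by
  intro q hq
  obtain ⟨p, hp, hqp, hpm⟩ := hm
    (q.comp (LinearMap.inl ℝ E E) + q.comp (LinearMap.inr ℝ E E)) (by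
      exact (hq.comp (continuous_id.prodMk continuous_const)).add
        (hq.comp (continuous_const.prodMk continuous_id)))
  refine ⟨p.comp (LinearMap.fst ℝ E E) + p.comp (LinearMap.snd ℝ E E), ?_, fun x => ?_,
    fun x y => ?_⟩
  · exact (hp.comp continuous_fst).add (hp.comp continuous_snd)
  · have h1 : q x ≤ q (x.1, 0) + q (0, x.2) := by
      have := map_add_le_add q (x.1, 0) (0, x.2)
      simpa using this
    have h2 : ∀ y, q (y, 0) + q (0, y) ≤ p y := fun y => hqp y
    have h3 := h2 x.1
    have h4 := h2 x.2
    have h5 := apply_nonneg q ((0 : E), x.1)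
    have h6 := apply_nonneg q (x.2, (0 : E))
    change q x ≤ p x.1 + p x.2
    linarith
  · change p (m x.1 y.1) + p (m x.1 y.2 + m x.2 y.1) ≤ (p x.1 + p x.2) * (p y.1 + p y.2)
    have h1 := hpm x.1 y.1
    have h2 := hpm x.1 y.2
    have h3 := hpm x.2 y.1
    have h4 := map_add_le_add p (m x.1 y.2) (m x.2 y.1)
    have h5 := mul_nonneg (apply_nonneg p x.2) (apply_nonneg p y.2)
    linarith

theorem IsSolution.tangent_fst {m : E →ₗ[ℝ] E →ₗ[ℝ] E} {e : E} {γ y : I → E} {H : I → E × E}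
    (h : IsSolution m.tangent (e, 0) (fun t => (γ t, y t)) H) :
    IsSolution m e γ fun t => (H t).1 where
  continuous := h.continuous.fst
  map_zero := by rw [h.map_zero]
  isWeakPrimitive := h.isWeakPrimitive.map (ContinuousLinearMap.fst ℝ E E)

variable [IsTopologicalAddGroup E] [ContinuousSMul ℝ E] [LocallyConvexSpace ℝ E] [T2Space E]
  {m : E →ₗ[ℝ] E →ₗ[ℝ] E}

omit [T2Space E] in
theorem HasLipschitzIntegrals.prod (hE : HasLipschitzIntegrals E) :
    HasLipschitzIntegrals (E × E) := by
  intro f hf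
  obtain ⟨v, hv⟩ := hE _ (hf.map (ContinuousLinearMap.fst ℝ E E))
  obtain ⟨w, hw⟩ := hE _ (hf.map (ContinuousLinearMap.snd ℝ E E))
  refine ⟨(v, w), fun φ => ?_⟩
  have hsplit : ∀ z : E × E, φ z = (φ.comp (ContinuousLinearMap.inl ℝ E E)) z.1 +
      (φ.comp (ContinuousLinearMap.inr ℝ E E)) z.2 := fun z => by
    simp [← map_add]
  have hfc := hf.continuous
  have h1 : ∀ u, φ (unitExt f u) =
      (φ.comp (ContinuousLinearMap.inl ℝ E E)) (unitExt (fun t => (f t).1) u) +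
      (φ.comp (ContinuousLinearMap.inr ℝ E E)) (unitExt (fun t => (f t).2) u) :=
    fun u => hsplit _
  simp only [h1]
  rw [intervalIntegral.integral_add
    (hfc.fst.intervalIntegrable_dual _ _ _)
    (hfc.snd.intervalIntegrable_dual _ _ _),
    hsplit]
  exact congrArg₂ _ (hv _) (hw _)

/-- The second component of `H` solves the linearized equation `h' = h γ + η y`. The remainder `X s
- η - s h` satisfies `R' = R γ + s (X s - η) y`. As `X s - η` is of order `s`, Gronwall's inequality
makes the remainder of order `s²`. -/
theorem IsSolution.hasDirDeriv (hm : IsLocallySubmultiplicative m) {e : E} {γ y η : I → E}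
    (hγ : Continuous γ) (hy : Continuous y) {H : I → E × E} {X : ℝ → I → E}
    (hη : IsSolution m e γ η)
    (hH : IsSolution m.tangent (e, 0) (fun t => (γ t, y t)) H)
    (hX : ∀ s, IsSolution m e (fun t => γ t + s • y t) (X s)) (t : I) :
    Tendsto (fun s : ℝ => s⁻¹ • (X s t - η t)) (𝓝[≠] 0) (𝓝 (H t).2) := by
  obtain rfl : (fun t => (H t).1) = η := hH.tangent_fst.unique hm hγ hη
  rw [tendsto_nhds_iff_seminorm]
  intro q hq
  obtain ⟨p, hp, hqp, hpm⟩ := hm q hq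
  obtain ⟨K, hK0, hK⟩ := hγ.exists_seminorm_bound hp
  obtain ⟨M, hM0, hM⟩ := hη.continuous.exists_seminorm_bound hp
  obtain ⟨N, hN0, hN⟩ := hy.exists_seminorm_bound hp
  set C := M * N * Real.exp (1 + K + N) with hC
  -- First-order bound; restricting to `|s| ≤ 1` makes `1 + K + N` a common bound for the driving
  -- curves `γ + s y`.
  have h1 : ∀ s : ℝ, |s| ≤ 1 → ∀ t, p (X s t - (H t).1) ≤ |s| * C := fun s hs t => by
    have := (hX s).seminorm_sub_le hm (hγ.add (hy.const_smul s)) hγ hη hp hpm (K := 1 + K + N)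
      (γ := fun t => γ t + s • y t)
      (δ := |s| * N) (by linarith) (fun t => ?_) hM (fun t => ?_) t
    · refine this.trans (le_of_eq ?_)
      rw [hC]; ring
    · refine (map_add_le_add p _ _).trans ?_
      rw [map_smul_eq_mul, Real.norm_eq_abs]
      have := mul_le_mul hs (hN t) (apply_nonneg _ _) zero_le_one
      linarith [hK t]
    · rw [add_sub_cancel_left, map_smul_eq_mul, Real.norm_eq_abs]
      exact mul_le_mul_of_nonneg_left (hN t) (abs_nonneg _)
  have hsnd : IsWeakPrimitive (fun t => (H t).2)
      fun t => m (H t).1 (y t) + m (H t).2 (γ t) :=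
    hH.isWeakPrimitive.map (ContinuousLinearMap.snd ℝ E E)
  have hc1 := hm.comp_continuous hη.continuous hy
  have hc2 := hm.comp_continuous hH.continuous.snd hγ
  have h2 : ∀ s : ℝ, |s| ≤ 1 →
      p (X s t - (H t).1 - s • (H t).2) ≤ |s| * |s| * (C * N) * Real.exp (1 + K) := fun s hs => by
    have hXc := (hX s).continuous
    have hc3 := hm.comp_continuous hXc (hγ.add (hy.const_smul s))
    refine seminorm_le_of_isWeakPrimitive hm hγ
      (β := fun t => s • m (X s t - (H t).1) (y t))
      (X := fun t => X s t - (H t).1 - s • (H t).2)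
      ((hm.comp_continuous (hXc.sub hη.continuous) hy).const_smul s)
      ((hXc.sub hη.continuous).sub (hH.continuous.snd.const_smul s))
      (by rw [(hX s).map_zero, hη.map_zero, hH.map_zero]; simp) ?_ hp hpm (K := 1 + K)
      (by linarith) (fun t => by linarith [hK t]) (fun t => ?_) t
    · convert ((hX s).isWeakPrimitive.sub hη.isWeakPrimitive hc3
        (hm.comp_continuous hη.continuous hγ)).sub (hsnd.const_smul s)
        (hc3.sub (hm.comp_continuous hη.continuous hγ)) ((hc1.add hc2).const_smul s) using 2 with t
      simp only [map_sub, map_add, LinearMap.sub_apply, map_smul, LinearMap.smul_apply, smul_add,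
        smul_sub]
      abel
    · rw [map_smul_eq_mul, Real.norm_eq_abs, mul_assoc |s|]
      refine mul_le_mul_of_nonneg_left ((hpm _ _).trans ?_) (abs_nonneg _)
      rw [← mul_assoc]
      exact mul_le_mul (h1 s hs t) (hN t) (apply_nonneg _ _) (by positivity)
  have h3 : ∀ᶠ s : ℝ in 𝓝[≠] 0, q (s⁻¹ • (X s t - (H t).1) - (H t).2) ≤
      |s| * ((C * N) * Real.exp (1 + K)) := by
    filter_upwards [self_mem_nhdsWithin,
      eventually_nhdsWithin_of_eventually_nhds (Metric.ball_mem_nhds (0 : ℝ) one_pos)] with s hs hs1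
    have hs0 : s ≠ 0 := hs
    have hs1 : |s| ≤ 1 := by simpa using (mem_ball_zero_iff.1 hs1).le
    have h4 : s⁻¹ • (X s t - (H t).1) - (H t).2 = s⁻¹ • (X s t - (H t).1 - s • (H t).2) := by
      rw [smul_sub _ _ (s • _), smul_smul, inv_mul_cancel₀ hs0, one_smul]
    refine (hqp _).trans ?_
    rw [h4, map_smul_eq_mul, Real.norm_eq_abs, abs_inv, inv_mul_le_iff₀ (abs_pos.2 hs0)]
    refine (h2 s hs1).trans (le_of_eq (by ring))
  refine squeeze_zero' (Eventually.of_forall fun _ => apply_nonneg _ _) h3 ?_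
  have h5 : Continuous fun s : ℝ => |s| * ((C * N) * Real.exp (1 + K)) := by fun_prop
  simpa using (h5.tendsto 0).mono_left nhdsWithin_le_nhds

end Tangent

/-- To show that a map is smooth, it suffices to embed it in a class of continuous maps which is
closed under directional derivatives. -/
theorem isSmoothOn_of_forall_exists_hasDirDerivAt {E F : Type*} [AddCommGroup E] [Module ℝ E]
    [TopologicalSpace E] [AddCommGroup F] [Module ℝ F] [TopologicalSpace F] {f : E → F} {U : Set E}
    (P : ∀ k, (E → (Fin k → E) → F) → Prop) (h0 : P 0 fun x _ => f x)
    (hc : ∀ k g, P k g → ContinuousOn (fun p : E × (Fin k → E) => g p.1 p.2) (U ×ˢ univ))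
    (hd : ∀ k g, P k g → ∃ g', P (k + 1) g' ∧ ∀ x ∈ U, ∀ y : Fin (k + 1) → E,
      HasDirDerivAt (fun z => g z (Fin.init y)) (g' x y) x (y (Fin.last k))) :
    IsSmoothOn f U := by
  have hd' : ∀ k (g : {g // P k g}), ∃ g' : {g // P (k + 1) g}, ∀ x ∈ U, ∀ y : Fin (k + 1) → E,
      HasDirDerivAt (fun z => g.1 z (Fin.init y)) (g'.1 x y) x (y (Fin.last k)) := fun k g => by
    obtain ⟨g', h1, h2⟩ := hd k g.1 g.2
    exact ⟨⟨g', h1⟩, h2⟩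
  choose next hnext using hd'
  let d : ∀ k, {g : E → (Fin k → E) → F // P k g} := fun k =>
    Nat.rec ⟨fun x _ => f x, h0⟩ (fun k g => next k g) k
  exact ⟨fun k => (d k).1, fun x _ y => rfl, fun k => hnext k (d k), fun k => hc k _ (d k).2⟩

/-! ### The space of smooth curves and its products -/

namespace SmoothPath

variable {E : Type*} [AddCommGroup E] [Module ℝ E] [TopologicalSpace E]
  [IsTopologicalAddGroup E] [ContinuousSMul ℝ E]

theorem iterDeriv_zero_apply (γ : SmoothPath E) (t : I) : γ.iterDeriv 0 t = γ.toFun t :=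
  γ.isDerivSeq.1 t

theorem iterDeriv_zero_coe (γ : SmoothPath E) : ⇑(γ.iterDeriv 0) = γ.toFun :=
  funext γ.iterDeriv_zero_apply

protected theorem continuous (γ : SmoothPath E) : Continuous γ.toFun :=
  γ.iterDeriv_zero_coe ▸ (γ.iterDeriv 0).continuous

theorem isSeminormLipschitz [LocallyConvexSpace ℝ E] (γ : SmoothPath E) :
    IsSeminormLipschitz γ.toFun := by
  rw [← γ.iterDeriv_zero_coe]
  exact (IsWeakPrimitive.of_hasCurveDerivAt (γ.iterDeriv 0).continuous (γ.iterDeriv 1).continuous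
    (γ.isDerivSeq.2 0)).isSeminormLipschitz (γ.iterDeriv 1).continuous

theorem iterDeriv_eq [T2Space E] {γ : SmoothPath E} {D : ℕ → C(I, E)}
    (h : IsDerivSeq γ.toFun D) (k : ℕ) : γ.iterDeriv k = D k :=
  congrFun (γ.isDerivSeq.unique h) k

theorem continuous_iterDeriv (k : ℕ) : Continuous (iterDeriv k : SmoothPath E → C(I, E)) :=
  continuous_iInf_dom (i := k) continuous_induced_dom

theorem continuous_rng {X : Type*} [TopologicalSpace X] {f : X → SmoothPath E}
    (h : ∀ k, Continuous fun x => (f x).iterDeriv k) : Continuous f :=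
  continuous_iInf_rng.2 fun k => continuous_induced_rng.2 (h k)

theorem isDerivSeq_prodMk (γ y : SmoothPath E) :
    IsDerivSeq (fun t => (γ.toFun t, y.toFun t))
      fun k => (γ.iterDeriv k).prodMk (y.iterDeriv k) :=
  ⟨fun t => Prod.ext (γ.isDerivSeq.1 t) (y.isDerivSeq.1 t), fun k t =>
    (γ.isDerivSeq.2 k t).prodMk_nhds (y.isDerivSeq.2 k t)⟩

/-- The smooth curve `t ↦ (γ t, y t)`. -/
def prodMk (γ y : SmoothPath E) : SmoothPath (E × E) :=
  ⟨fun t => (γ.toFun t, y.toFun t), _, isDerivSeq_prodMk γ y⟩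

theorem iterDeriv_prodMk [T2Space E] (γ y : SmoothPath E) (k : ℕ) :
    (prodMk γ y).iterDeriv k = (γ.iterDeriv k).prodMk (y.iterDeriv k) :=
  iterDeriv_eq (γ := prodMk γ y) (isDerivSeq_prodMk γ y) k

theorem continuous_prodMk [T2Space E] :
    Continuous fun z : SmoothPath E × SmoothPath E => prodMk z.1 z.2 := by
  refine continuous_rng fun k => ?_
  simp only [iterDeriv_prodMk]
  refine ContinuousMap.continuous_of_continuous_uncurry _ ?_
  have h1 : Continuous fun x : (SmoothPath E × SmoothPath E) × I => x.1.1.iterDeriv k x.2 :=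
    ((continuous_iterDeriv k).comp (continuous_fst.comp continuous_fst)).eval continuous_snd
  have h2 : Continuous fun x : (SmoothPath E × SmoothPath E) × I => x.1.2.iterDeriv k x.2 :=
    ((continuous_iterDeriv k).comp (continuous_snd.comp continuous_fst)).eval continuous_snd
  exact h1.prodMk h2

variable (E) in
/-- The identification of pairs of smooth curves with smooth curves in the product. -/
def prodMkL [T2Space E] : SmoothPath E × SmoothPath E →L[ℝ] SmoothPath (E × E) where
  toFun z := prodMk z.1 z.2
  map_add' _ _ := rfl
  map_smul' _ _ := rfl
  cont := continuous_prodMk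

end SmoothPath

/-- `ev γ` is the value at `1` of the solution of `η' = m η γ`, `η 0 = e`. -/
def IsEndpointMap {E : Type*} [AddCommGroup E] [Module ℝ E] [TopologicalSpace E]
    [IsTopologicalAddGroup E] [ContinuousSMul ℝ E] (m : E →ₗ[ℝ] E →ₗ[ℝ] E) (e : E)
    (ev : SmoothPath E → E) : Prop :=
  ∀ γ : SmoothPath E, ∃ η, IsSolution m e γ.toFun η ∧ η 1 = ev γ

/-! ### Smoothness of the endpoint map -/

section Endpoint

variable {E : Type*} [AddCommGroup E] [Module ℝ E] [TopologicalSpace E]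
  [IsTopologicalAddGroup E] [ContinuousSMul ℝ E] [LocallyConvexSpace ℝ E]
  {m : E →ₗ[ℝ] E →ₗ[ℝ] E} {e : E}

theorem HasLipschitzIntegrals.exists_isEndpointMap [T2Space E] (hE : HasLipschitzIntegrals E)
    (hm : IsLocallySubmultiplicative m) (e : E) : ∃ ev, IsEndpointMap m e ev := by
  choose η hη using fun γ : SmoothPath E => hE.exists_isSolution hm e γ.isSeminormLipschitz
  exact ⟨fun γ => η γ 1, fun γ => ⟨η γ, hη γ, rfl⟩⟩

theorem IsEndpointMap.continuous {ev : SmoothPath E → E} (hev : IsEndpointMap m e ev)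
    (hm : IsLocallySubmultiplicative m) : Continuous ev := by
  rw [continuous_iff_continuousAt]
  intro γ₀
  rw [ContinuousAt, tendsto_nhds_iff_seminorm]
  intro q hq
  obtain ⟨p, hp, hqp, hpm⟩ := hm q hq
  obtain ⟨η₀, h₀, h₀'⟩ := hev γ₀
  obtain ⟨K, hK0, hK⟩ := γ₀.continuous.exists_seminorm_bound hp
  obtain ⟨M, hM0, hM⟩ := h₀.continuous.exists_seminorm_bound hp
  -- The uniform `p`-distance to `γ₀`; it involves no derivatives of the curves, so the endpoint map
  -- is continuous already for uniform convergence.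
  let δ : SmoothPath E → ℝ := fun γ =>
    ‖(⟨p, hp⟩ : C(E, ℝ)).comp (γ.iterDeriv 0 - γ₀.iterDeriv 0)‖
  have hδ : ∀ γ t, p (γ.toFun t - γ₀.toFun t) ≤ δ γ := fun γ t => by
    have := ContinuousMap.norm_coe_le_norm
      ((⟨p, hp⟩ : C(E, ℝ)).comp (γ.iterDeriv 0 - γ₀.iterDeriv 0)) t
    refine le_trans (le_of_eq ?_) ((le_abs_self _).trans this)
    simp [SmoothPath.iterDeriv_zero_apply]
  have hδc : Continuous δ := by
    have h1 : Continuous fun γ : SmoothPath E => γ.iterDeriv 0 - γ₀.iterDeriv 0 :=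
      (SmoothPath.continuous_iterDeriv 0).sub continuous_const
    exact ((ContinuousMap.continuous_postcomp (⟨p, hp⟩ : C(E, ℝ))).comp h1).norm
  have hδ0 : δ γ₀ = 0 := by
    refine norm_eq_zero.2 ?_
    ext t
    simp
  have h1 : ∀ γ, q (ev γ - ev γ₀) ≤ M * δ γ * Real.exp (1 + K + δ γ) := fun γ => by
    obtain ⟨η, h, h'⟩ := hev γ
    rw [← h', ← h₀']
    have hδ0 : 0 ≤ δ γ := norm_nonneg _
    refine (hqp _).trans (h.seminorm_sub_le hm γ.continuous γ₀.continuous h₀ hp hpm (by linarith)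
      (fun t => ?_) hM (hδ γ) 1)
    have := map_add_le_add p (γ.toFun t - γ₀.toFun t) (γ₀.toFun t)
    rw [sub_add_cancel] at this
    linarith [hδ γ t, hK t]
  refine squeeze_zero (fun _ => apply_nonneg _ _) h1 ?_
  have h2 : Continuous fun γ => M * δ γ * Real.exp (1 + K + δ γ) := by fun_prop
  simpa [hδ0] using h2.tendsto γ₀

theorem IsEndpointMap.hasDirDerivAt [T2Space E] (hm : IsLocallySubmultiplicative m)
    {ev : SmoothPath E → E} (hev : IsEndpointMap m e ev) {ev' : SmoothPath (E × E) → E × E}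
    (hev' : IsEndpointMap m.tangent (e, 0) ev') (γ y : SmoothPath E) :
    HasDirDerivAt ev (ev' (SmoothPath.prodMkL E (γ, y))).2 γ y := by
  obtain ⟨η, h, h'⟩ := hev γ
  obtain ⟨H, hH, hH'⟩ := hev' (SmoothPath.prodMkL E (γ, y))
  choose X hX hX' using fun s : ℝ => hev (γ + s • y)
  have := h.hasDirDeriv hm γ.continuous y.continuous hH hX 1
  rw [hH', h'] at this
  simp only [hX'] at this
  exact this

/-- The class of maps obtained from endpoint maps by composition with linear maps. -/
inductive IsLinearlyEndpoint (X : Type v) (A : Type u) [AddCommGroup X] [Module ℝ X]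
    [TopologicalSpace X] [AddCommGroup A] [Module ℝ A] [TopologicalSpace A] :
    ∀ k, (X → (Fin k → X) → A) → Prop
  | mk {k : ℕ} (B : Type u) [AddCommGroup B] [Module ℝ B] [TopologicalSpace B]
      [IsTopologicalAddGroup B] [ContinuousSMul ℝ B] [LocallyConvexSpace ℝ B] [T2Space B]
      (hB : HasLipschitzIntegrals B) {m : B →ₗ[ℝ] B →ₗ[ℝ] B} (hm : IsLocallySubmultiplicative m)
      {e : B} {ev : SmoothPath B → B} (hev : IsEndpointMap m e ev)
      (ι : X × (Fin k → X) →L[ℝ] SmoothPath B) (π : B →L[ℝ] A) :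
      IsLinearlyEndpoint X A k fun x y => π (ev (ι (x, y)))

theorem IsLinearlyEndpoint.continuous {X : Type v} {A : Type u} [AddCommGroup X] [Module ℝ X]
    [TopologicalSpace X] [AddCommGroup A] [Module ℝ A] [TopologicalSpace A] {k : ℕ}
    {g : X → (Fin k → X) → A} (hg : IsLinearlyEndpoint X A k g) :
    Continuous fun p : X × (Fin k → X) => g p.1 p.2 := by
  obtain ⟨B, hB, hm, hev, ι, π⟩ := hg
  exact π.continuous.comp ((hev.continuous hm).comp ι.continuous)

/-- Differentiation replaces the algebra `B` by its dual numbers `B × B`, which lies in the same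
class and the same universe, so the procedure can be repeated indefinitely. -/
theorem IsLinearlyEndpoint.exists_hasDirDerivAt {X : Type v} {A : Type u} [AddCommGroup X]
    [Module ℝ X] [TopologicalSpace X] [AddCommGroup A] [Module ℝ A] [TopologicalSpace A] {k : ℕ}
    {g : X → (Fin k → X) → A} (hg : IsLinearlyEndpoint X A k g) :
    ∃ g', IsLinearlyEndpoint X A (k + 1) g' ∧ ∀ x (y : Fin (k + 1) → X),
      HasDirDerivAt (fun z => g z (Fin.init y)) (g' x y) x (y (Fin.last k)) := by
  obtain ⟨B, hB, hm, hev, ι, π⟩ := hg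
  rename_i m e ev
  obtain ⟨ev', hev'⟩ := hB.prod.exists_isEndpointMap hm.tangent (e, 0)
  -- `c₁` yields the base point `(x, Fin.init y)` and `c₂` the increment `(y (Fin.last k), 0)`: only
  -- the first argument moves, and both depend linearly on `(x, y)`.
  let c₁ : X × (Fin (k + 1) → X) →L[ℝ] X × (Fin k → X) :=
    (ContinuousLinearMap.fst ℝ _ _).prod
      ((ContinuousLinearMap.pi fun i : Fin k => ContinuousLinearMap.proj i.castSucc).comp
        (ContinuousLinearMap.snd ℝ _ _))
  let c₂ : X × (Fin (k + 1) → X) →L[ℝ] X × (Fin k → X) :=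
    ((ContinuousLinearMap.proj (Fin.last k)).comp (ContinuousLinearMap.snd ℝ _ _)).prod 0
  refine ⟨_, .mk (B × B) hB.prod hm.tangent hev'
    ((SmoothPath.prodMkL B).comp ((ι.comp c₁).prod (ι.comp c₂)))
    (π.comp (ContinuousLinearMap.snd ℝ _ _)), fun x y => ?_⟩
  have h1 := hev.hasDirDerivAt hm hev' (ι (c₁ (x, y))) (ι (c₂ (x, y)))
  refine ((π.continuous.tendsto _).comp h1).congr fun s => ?_
  have h2 : ι (c₁ (x, y)) + s • ι (c₂ (x, y)) = ι (x + s • y (Fin.last k), Fin.init y) := by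
    rw [← map_smul, ← map_add]
    congr 1
    ext i
    · rfl
    · change y i.castSucc + s • (0 : X) = y i.castSucc
      simp
  rw [Function.comp, h2, map_smul, map_sub]
  rfl

theorem IsEndpointMap.isSmoothOn {E : Type u} [AddCommGroup E] [Module ℝ E] [TopologicalSpace E]
    [IsTopologicalAddGroup E] [ContinuousSMul ℝ E] [LocallyConvexSpace ℝ E] [T2Space E]
    {m : E →ₗ[ℝ] E →ₗ[ℝ] E} {e : E} (hE : HasLipschitzIntegrals E)
    (hm : IsLocallySubmultiplicative m) {ev : SmoothPath E → E} (hev : IsEndpointMap m e ev)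
    (U : Set (SmoothPath E)) : IsSmoothOn ev U :=
  isSmoothOn_of_forall_exists_hasDirDerivAt (IsLinearlyEndpoint (SmoothPath E) E)
    (.mk E hE hm hev (ContinuousLinearMap.fst ℝ _ _) (.id ℝ E))
    (fun _ _ hg => hg.continuous.continuousOn)
    fun _ _ hg => by
      obtain ⟨g', h1, h2⟩ := hg.exists_hasDirDerivAt
      exact ⟨g', h1, fun x _ => h2 x⟩

end Endpoint

/-! ### Smoothness of rational maps in a continuous inverse algebra -/

section Rational

variable {E A : Type*} [AddCommGroup E] [Module ℝ E] [TopologicalSpace E] [Ring A] [Algebra ℝ A]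
  [TopologicalSpace A]

/-- Maps on `U ⊆ E` which are obtained from linear maps by sums, products and inverses. -/
inductive IsRational (A : Type*) [Ring A] [Algebra ℝ A] [TopologicalSpace A] (U : Set E) :
    ∀ k, (E → (Fin k → E) → A) → Prop
  | lin {k : ℕ} (L : E × (Fin k → E) →L[ℝ] A) : IsRational A U k fun x y => L (x, y)
  | inv {k : ℕ} (L : E →L[ℝ] A) (hL : ∀ x ∈ U, IsUnit (L x)) :
      IsRational A U k fun x _ => Ring.inverse (L x)
  | add {k : ℕ} {f g : E → (Fin k → E) → A} (hf : IsRational A U k f) (hg : IsRational A U k g) :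
      IsRational A U k fun x y => f x y + g x y
  | neg {k : ℕ} {f : E → (Fin k → E) → A} (hf : IsRational A U k f) :
      IsRational A U k fun x y => -f x y
  | mul {k : ℕ} {f g : E → (Fin k → E) → A} (hf : IsRational A U k f) (hg : IsRational A U k g) :
      IsRational A U k fun x y => f x y * g x y

theorem IsRational.init {U : Set E} {k : ℕ} {f : E → (Fin k → E) → A} (hf : IsRational A U k f) :
    IsRational A U (k + 1) fun x y => f x (Fin.init y) := by
  induction hf with
  | lin L =>
    exact .lin (L.comp ((ContinuousLinearMap.fst ℝ _ _).prod
      ((ContinuousLinearMap.pi fun i : Fin _ => ContinuousLinearMap.proj i.castSucc).comp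
        (ContinuousLinearMap.snd ℝ _ _))))
  | inv L hL => exact .inv L hL
  | add _ _ h1 h2 => exact .add h1 h2
  | neg _ h1 => exact .neg h1
  | mul _ _ h1 h2 => exact .mul h1 h2

variable [IsTopologicalRing A] [IsContinuousInverseAlgebra A]

theorem IsRational.continuousOn {U : Set E} {k : ℕ} {f : E → (Fin k → E) → A}
    (hf : IsRational A U k f) :
    ContinuousOn (fun p : E × (Fin k → E) => f p.1 p.2) (U ×ˢ univ) := by
  induction hf with
  | lin L => exact L.continuous.continuousOn
  | inv L hL =>
    exact (IsContinuousInverseAlgebra.continuousOn_inverse (A := A)).comp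
      (L.continuous.comp continuous_fst).continuousOn fun p hp => hL _ hp.1
  | add _ _ h1 h2 => exact h1.add h2
  | neg _ h1 => exact h1.neg
  | mul _ _ h1 h2 => exact h1.mul h2

variable [ContinuousSMul ℝ A]

/-- The resolvent identity gives the difference quotient as `-(x + t y)⁻¹ y x⁻¹`, and continuity of
inversion gives its limit. -/
theorem hasDirDerivAt_ringInverse {x : A} (hx : IsUnit x) (y : A) :
    HasDirDerivAt Ring.inverse (-(Ring.inverse x * y * Ring.inverse x)) x y := by
  have hlin : Tendsto (fun t : ℝ => x + t • y) (𝓝[≠] 0) (𝓝 x) := by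
    have : Continuous fun t : ℝ => x + t • y := by fun_prop
    simpa using (this.tendsto 0).mono_left nhdsWithin_le_nhds
  have hopen := (IsContinuousInverseAlgebra.isOpen_units (A := A)).mem_nhds hx
  have hinv : Tendsto (fun t : ℝ => Ring.inverse (x + t • y)) (𝓝[≠] 0) (𝓝 (Ring.inverse x)) :=
    ((IsContinuousInverseAlgebra.continuousOn_inverse (A := A)).continuousAt hopen).tendsto.comp
      hlin
  refine Tendsto.congr' ?_ ((hinv.mul_const y).mul_const (Ring.inverse x)).neg
  filter_upwards [hlin hopen, self_mem_nhdsWithin] with t ht ht0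
  have ht0 : t ≠ 0 := ht0
  have h1 : Ring.inverse (x + t • y) - Ring.inverse x =
      t • (-(Ring.inverse (x + t • y) * y * Ring.inverse x)) := by
    calc Ring.inverse (x + t • y) - Ring.inverse x
        = Ring.inverse (x + t • y) * (x * Ring.inverse x) -
          (Ring.inverse (x + t • y) * (x + t • y)) * Ring.inverse x := by
          rw [Ring.mul_inverse_cancel _ hx, Ring.inverse_mul_cancel _ ht, mul_one, one_mul]
      _ = _ := by
          rw [← mul_assoc, ← sub_mul, ← mul_sub, sub_add_cancel_left, mul_neg, neg_mul,
            mul_smul_comm, smul_mul_assoc, smul_neg]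
  rw [h1, smul_smul, inv_mul_cancel₀ ht0, one_smul]

theorem IsRational.exists_hasDirDerivAt {U : Set E} {k : ℕ}
    {f : E → (Fin k → E) → A} (hf : IsRational A U k f) :
    ∃ f', IsRational A U (k + 1) f' ∧ ∀ x ∈ U, ∀ y : Fin (k + 1) → E,
      HasDirDerivAt (fun z => f z (Fin.init y)) (f' x y) x (y (Fin.last k)) := by
  induction hf with
  | lin L =>
    refine ⟨_, .lin (L.comp (((ContinuousLinearMap.proj (Fin.last k)).comp
      (ContinuousLinearMap.snd ℝ _ _)).prod 0)), fun x _ y => ?_⟩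
    refine tendsto_const_nhds.congr' ?_
    filter_upwards [self_mem_nhdsWithin] with t ht
    have ht : t ≠ 0 := ht
    have h1 : ((x + t • y (Fin.last k), Fin.init y) : E × (Fin k → E)) - (x, Fin.init y) =
        t • (y (Fin.last k), 0) := by
      ext i <;> simp
    rw [← map_sub, h1, map_smul, smul_smul, inv_mul_cancel₀ ht, one_smul]
    rfl
  | inv L hL =>
    let l : E × (Fin (k + 1) → E) →L[ℝ] A := L.comp ((ContinuousLinearMap.proj (Fin.last k)).comp
      (ContinuousLinearMap.snd ℝ _ _))
    refine ⟨_, .neg (.mul (.mul (.inv L hL) (.lin l)) (.inv L hL)), fun x hx y => ?_⟩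
    have := hasDirDerivAt_ringInverse (hL x hx) (L (y (Fin.last k)))
    refine this.congr fun t => ?_
    simp only [map_add, map_smul]
  | add _ _ h1 h2 =>
    obtain ⟨f', h1, h1'⟩ := h1
    obtain ⟨g', h2, h2'⟩ := h2
    refine ⟨_, .add h1 h2, fun x hx y => ((h1' x hx y).add (h2' x hx y)).congr fun t => ?_⟩
    rw [← smul_add]
    exact congrArg _ (add_sub_add_comm _ _ _ _).symm
  | neg _ h1 =>
    obtain ⟨f', h1, h1'⟩ := h1
    refine ⟨_, .neg h1, fun x hx y => (h1' x hx y).neg.congr fun t => ?_⟩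
    rw [← smul_neg]
    exact congrArg _ ((neg_sub _ _).trans (neg_sub_neg _ _).symm)
  | mul hf hg h1 h2 =>
    rename_i f g
    obtain ⟨f', h1, h1'⟩ := h1
    obtain ⟨g', h2, h2'⟩ := h2
    refine ⟨_, .add (.mul h1 hg.init) (.mul hf.init h2), fun x hx y => ?_⟩
    have hg' : Tendsto (fun t : ℝ => g (x + t • y (Fin.last k)) (Fin.init y)) (𝓝[≠] 0)
        (𝓝 (g x (Fin.init y))) := by
      have h3 := (tendsto_id.mono_left nhdsWithin_le_nhds : Tendsto id (𝓝[≠] (0 : ℝ)) (𝓝 0)).smul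
        (h2' x hx y)
      rw [zero_smul] at h3
      have h4 := h3.add_const (g x (Fin.init y))
      rw [zero_add] at h4
      refine h4.congr' ?_
      filter_upwards [self_mem_nhdsWithin] with t ht
      have ht : t ≠ 0 := ht
      rw [id, smul_smul, mul_inv_cancel₀ ht, one_smul, sub_add_cancel]
    refine (((h1' x hx y).mul hg').add ((h2' x hx y).const_mul (f x (Fin.init y)))).congr
      fun t => ?_
    rw [smul_mul_assoc, mul_smul_comm, ← smul_add]
    congr 1
    rw [sub_mul, mul_sub]
    exact sub_add_sub_cancel _ _ _

theorem IsRational.isSmoothOn {U : Set E} {f : E → A} (hf : IsRational A U 0 fun x _ => f x) :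
    IsSmoothOn f U :=
  isSmoothOn_of_forall_exists_hasDirDerivAt (IsRational A U) hf (fun _ _ h => h.continuousOn)
    fun _ _ h => h.exists_hasDirDerivAt

end Rational

/-! ### The polarization formula -/

section Polarization

/-- The polarization formula. -/
theorem factorial_mul_prod_eq_sum_powerset {R : Type*} [CommRing R] {n : ℕ} (x : Fin n → R) :
    (n.factorial : R) * ∏ i, x i =
      ∑ s : Finset (Fin n), (-1) ^ (Finset.univ \ s).card * (∑ i ∈ s, x i) ^ n := by
  classical
  -- The power is expanded over maps `g`. The indicator that `g` takes values in `s` is absorbed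
  -- into the sign: the product over the complement of `s` vanishes as soon as `g` leaves `s`.
  have h1 : ∀ s : Finset (Fin n), (-1 : R) ^ (Finset.univ \ s).card * (∑ i ∈ s, x i) ^ n =
      ∑ g : Fin n → Fin n, (∏ _i ∈ s, (1 : R)) *
        (∏ i ∈ Finset.univ \ s, (-(if i ∈ Set.range g then 0 else 1))) * ∏ i, x (g i) := by
    intro s
    have h2 : (∑ i ∈ s, x i) ^ n =
        ∑ g : Fin n → Fin n, if ∀ i, g i ∈ s then ∏ i, x (g i) else 0 := by
      rw [Finset.sum_pow', ← Finset.sum_filter]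
      refine Finset.sum_congr ?_ fun _ _ => rfl
      ext g
      simp [Fintype.mem_piFinset]
    rw [h2, Finset.mul_sum]
    refine Finset.sum_congr rfl fun g _ => ?_
    rw [Finset.prod_const_one, one_mul]
    split_ifs with h
    · congr 1
      rw [← Finset.prod_const]
      refine Finset.prod_congr rfl fun i hi => ?_
      rw [if_neg]
      rintro ⟨j, rfl⟩
      exact (Finset.mem_sdiff.1 hi).2 (h j)
    · push Not at h
      obtain ⟨j, hj⟩ := h
      rw [Finset.prod_eq_zero (Finset.mem_sdiff.2 ⟨Finset.mem_univ _, hj⟩), mul_zero, zero_mul]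
      simp
  simp_rw [h1]
  rw [Finset.sum_comm]
  simp_rw [← Finset.sum_mul]
  have h3 : ∀ g : Fin n → Fin n, (∑ s : Finset (Fin n), (∏ _i ∈ s, (1 : R)) *
      ∏ i ∈ Finset.univ \ s, (-(if i ∈ Set.range g then 0 else 1))) =
      if Function.Bijective g then 1 else 0 := by
    intro g
    -- The sum over `s` factors as a product over `i` of `1 - 1 = 0` if `g` misses `i` and `1 + 0 =
    -- 1` otherwise, so only the `n!` permutations survive.
    rw [← Finset.powerset_univ, ← Finset.prod_add]
    split_ifs with h
    · refine Finset.prod_eq_one fun i _ => ?_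
      rw [if_pos (Set.mem_range.2 (h.2 i))]
      simp
    · rw [← Finite.surjective_iff_bijective] at h
      simp only [Function.Surjective, not_forall] at h
      obtain ⟨i, hi⟩ := h
      refine Finset.prod_eq_zero (Finset.mem_univ i) ?_
      rw [if_neg fun hmem => hi (Set.mem_range.1 hmem)]
      simp
  simp_rw [h3, ite_mul, one_mul, zero_mul]
  rw [← Finset.sum_filter]
  have h4 : ∀ g ∈ Finset.univ.filter (fun g : Fin n → Fin n => Function.Bijective g),
      ∏ i, x (g i) = ∏ i, x i := fun g hg =>
    (Finset.mem_filter.1 hg).2.prod_comp x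
  rw [Finset.sum_congr rfl h4, Finset.sum_const, nsmul_eq_mul]
  congr 2
  let ψ (e : Equiv.Perm (Fin n)) : Subtype (fun g : Fin n → Fin n => Function.Bijective g) :=
    ⟨e, e.bijective⟩
  have hψ : Function.Bijective ψ :=
    ⟨fun _ _ h => Equiv.coe_fn_injective (congrArg Subtype.val h),
      fun g => ⟨Equiv.ofBijective g.1 g.2, rfl⟩⟩
  rw [← Fintype.card_subtype, ← Fintype.card_of_bijective hψ, Fintype.card_perm, Fintype.card_fin]

end Polarization

/-! ### Partial fractions of `1 / (1 - x ^ m)` in real form -/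

section RootsOfUnity

open Real

theorem sum_cos_two_pi_mul_div {m j : ℕ} (hj : j ≠ 0) (hjm : j < m) :
    ∑ k ∈ Finset.range m, cos (j * (2 * π * k / m)) = 0 := by
  have hm : m ≠ 0 := by omega
  have hm' : (m : ℂ) ≠ 0 := by exact_mod_cast hm
  have hζ := Complex.isPrimitiveRoot_exp m hm
  set ζ := Complex.exp (2 * π * Complex.I / m) with hζdef
  have h1 : ∑ k ∈ Finset.range m, (ζ ^ j) ^ k = 0 := by
    have h2 := mul_neg_geom_sum (ζ ^ j) m
    rw [← pow_mul, mul_comm j m, pow_mul, hζ.pow_eq_one, one_pow, sub_self] at h2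
    exact (mul_eq_zero.1 h2).resolve_left
      (sub_ne_zero.2 (hζ.pow_ne_one_of_pos_of_lt hj hjm).symm)
  have h3 : ∀ k ∈ Finset.range m, cos (j * (2 * π * k / m)) = ((ζ ^ j) ^ k).re := fun k _ => by
    rw [← pow_mul, hζdef, ← Complex.exp_nat_mul]
    have : ((j * k : ℕ) : ℂ) * (2 * π * Complex.I / m) =
        ((j * (2 * π * k / m) : ℝ) : ℂ) * Complex.I := by
      push_cast; ring
    rw [this, Complex.exp_ofReal_mul_I_re]
  rw [Finset.sum_congr rfl h3, ← Complex.re_sum, h1, Complex.zero_re]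

/-- The real part of the geometric sum of `exp (i θ) x`, multiplied by the product of `1 - exp (± i
θ) x`. The last coefficient is `cos ((m - 1) θ)`, written out so that `m = 0` needs no special
treatment. -/
theorem mul_sum_cos_smul_pow {R : Type*} [CommRing R] [Algebra ℝ R] (θ : ℝ) (x : R) (m : ℕ) :
    (1 - (2 * cos θ) • x + x ^ 2) * ∑ j ∈ Finset.range m, cos (j * θ) • x ^ j =
      1 - cos θ • x - cos (m * θ) • x ^ m +
        (cos (m * θ) * cos θ + sin (m * θ) * sin θ) • x ^ (m + 1) := by
  induction m with
  | zero => simp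
  | succ m ih =>
    rw [Finset.sum_range_succ, mul_add, ih]
    have h1 : cos ((m + 1 : ℕ) * θ) = cos (m * θ) * cos θ - sin (m * θ) * sin θ := by
      push_cast; rw [add_mul, one_mul, cos_add]
    have h2 : cos ((m + 1 : ℕ) * θ) * cos θ + sin ((m + 1 : ℕ) * θ) * sin θ = cos (m * θ) := by
      rw [← cos_sub]; congr 1; push_cast; ring
    rw [h2, h1]
    simp only [Algebra.smul_def, map_add, map_sub, map_mul, map_ofNat]
    ring

/-- Averaging `1 / (1 - ζ x)` over the `m`-th roots of unity `ζ` gives `1 / (1 - x ^ m)`. Combining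
conjugate roots yields the real fractions `(1 - cos θ x) / (1 - 2 cos θ x + x²)`, so no
complexification is needed. For `θ = 2 π k / m` one has `cos (m θ) = 1` and `sin (m θ) = 0`, and
averaging over `k` leaves only the constant term. -/
theorem sum_inverse_mul_one_sub_pow {R : Type*} [CommRing R] [Algebra ℝ R] {x : R} {m : ℕ}
    (hm : 0 < m) (hu : ∀ k < m, IsUnit (1 - (2 * cos (2 * π * k / m)) • x + x ^ 2)) :
    ((m : ℝ)⁻¹ • ∑ k ∈ Finset.range m, (1 - cos (2 * π * k / m) • x) *
      Ring.inverse (1 - (2 * cos (2 * π * k / m)) • x + x ^ 2)) * (1 - x ^ m) = 1 := by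
  have hm' : (m : ℝ) ≠ 0 := by exact_mod_cast hm.ne'
  have h1 : ∀ k ∈ Finset.range m, (1 - cos (2 * π * k / m) • x) *
      Ring.inverse (1 - (2 * cos (2 * π * k / m)) • x + x ^ 2) * (1 - x ^ m) =
      ∑ j ∈ Finset.range m, cos (j * (2 * π * k / m)) • x ^ j := fun k hk => by
    have h2 := mul_sum_cos_smul_pow (2 * π * k / m) x m
    have h3 : (m : ℝ) * (2 * π * k / m) = k * (2 * π) := by field_simp
    have h4 : sin (k * (2 * π)) = 0 := by
      have := sin_nat_mul_pi (2 * k)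
      rw [← this]; congr 1; push_cast; ring
    rw [h3, cos_nat_mul_two_pi, h4, zero_mul, add_zero, one_mul, one_smul] at h2
    have h5 : (1 - cos (2 * π * k / m) • x) * (1 - x ^ m) =
        1 - cos (2 * π * k / m) • x - x ^ m + cos (2 * π * k / m) • x ^ (m + 1) := by
      simp only [Algebra.smul_def]; ring
    rw [← h5] at h2
    rw [mul_right_comm, ← h2, mul_right_comm, Ring.mul_inverse_cancel _ (hu k (Finset.mem_range.1 hk)), one_mul]
  rw [smul_mul_assoc, Finset.sum_mul, Finset.sum_congr rfl h1, Finset.sum_comm]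
  simp_rw [← Finset.sum_smul]
  rw [Finset.sum_eq_single_of_mem 0 (Finset.mem_range.2 hm)]
  · simp [smul_smul, hm']
  · intro j hj hj0
    rw [sum_cos_two_pi_mul_div hj0 (Finset.mem_range.1 hj), zero_smul]

end RootsOfUnity

/-! ### Submultiplicative seminorms as gauges -/

section Gauge

theorem Seminorm.map_sum_le {E ι : Type*} [AddCommGroup E] [Module ℝ E] (p : Seminorm ℝ E)
    (s : Finset ι) (f : ι → E) : p (∑ i ∈ s, f i) ≤ ∑ i ∈ s, p (f i) :=
  Finset.le_sum_of_subadditive p (map_zero p).le (map_add_le_add p) s f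

variable {A : Type*} [Ring A] [Algebra ℝ A] [TopologicalSpace A] [IsTopologicalRing A]
  [ContinuousSMul ℝ A]

/-- The products of elements of the unit ball of `p` form a multiplicatively closed set `S`. Its
convex hull is closed under multiplication too, is a neighbourhood of zero and lies in the unit ball
of `q`, so its gauge has the required properties. -/
theorem exists_submultiplicative_of_list_prod {p q : Seminorm ℝ A} (hp : Continuous p)
    (h : ∀ l : List A, l ≠ [] → (∀ x ∈ l, p x ≤ 1) → q l.prod ≤ 1) :
    ∃ r : Seminorm ℝ A, Continuous r ∧ q ≤ r ∧ ∀ x y, r (x * y) ≤ r x * r y := by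
  set S : Set A := {x | ∃ l : List A, l ≠ [] ∧ (∀ x ∈ l, p x ≤ 1) ∧ l.prod = x} with hS
  have hpS : {x | p x ≤ 1} ⊆ S := fun x hx => ⟨[x], by simp, by simpa using hx, by simp⟩
  have hbal : Balanced ℝ S := by
    rintro c hc _ ⟨_, ⟨l, hl, hl1, rfl⟩, rfl⟩
    -- A scalar is absorbed into the first factor; this is where the empty product has to be
    -- excluded.
    obtain ⟨a, l, rfl⟩ := List.exists_cons_of_ne_nil hl
    refine ⟨(c • a) :: l, by simp, fun x hx => ?_, by simp⟩
    rcases List.mem_cons.1 hx with rfl | hx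
    · rw [map_smul_eq_mul]
      exact mul_le_one₀ hc (apply_nonneg _ _) (hl1 _ (by simp))
    · exact hl1 _ (by simp [hx])
  have hmul : ∀ x ∈ S, ∀ y ∈ S, x * y ∈ S := by
    rintro _ ⟨l, hl, hl1, rfl⟩ _ ⟨l', hl', hl1', rfl⟩
    refine ⟨l ++ l', by simp [hl], fun x hx => ?_, List.prod_append⟩
    rcases List.mem_append.1 hx with hx | hx
    exacts [hl1 x hx, hl1' x hx]
  set K := convexHull ℝ S with hK
  have hSK : S ⊆ K := subset_convexHull ℝ S
  have hKc : Convex ℝ K := convex_convexHull ℝ S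
  have hKn : K ∈ 𝓝 (0 : A) := by
    have : {x | p x < 1} ∈ 𝓝 (0 : A) :=
      hp.continuousAt.eventually_lt continuousAt_const (by simp)
    refine mem_of_superset this fun x hx => hSK (hpS ?_)
    have hx : p x < 1 := hx
    exact hx.le
  have hKa : Absorbent ℝ K := absorbent_nhds_zero hKn
  have hKmul : ∀ x ∈ K, ∀ y ∈ K, x * y ∈ K := by
    have h1 : ∀ y ∈ S, ∀ x ∈ K, x * y ∈ K := fun y hy =>
      convexHull_min (s := S) (t := (LinearMap.mulRight ℝ y) ⁻¹' K)
        (fun x hx => hSK (hmul x hx y hy)) (hKc.linear_preimage _)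
    intro x hx
    exact convexHull_min (s := S) (t := (LinearMap.mulLeft ℝ x) ⁻¹' K)
      (fun y hy => h1 y hy x hx) (hKc.linear_preimage _)
  have hKq : ∀ x ∈ K, q x ≤ 1 := by
    have h1 : K ⊆ q.closedBall 0 1 := by
      refine convexHull_min ?_ (q.convex_closedBall 0 1)
      rintro _ ⟨l, hl, hl1, rfl⟩
      exact (q.mem_closedBall_zero).2 (h l hl hl1)
    exact fun x hx => (q.mem_closedBall_zero).1 (h1 hx)
  refine ⟨gaugeSeminorm hbal.convexHull hKc hKa, continuous_gauge hKc hKn, fun x => ?_,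
    fun x y => ?_⟩
  · change q x ≤ gauge K x
    refine le_of_forall_gt fun a ha => ?_
    obtain ⟨b, hb0, hba, z, hz, rfl⟩ := exists_lt_of_gauge_lt hKa ha
    refine lt_of_le_of_lt ?_ hba
    simp only
    rw [map_smul_eq_mul, Real.norm_of_nonneg hb0.le]
    exact mul_le_of_le_one_right hb0.le (hKq z hz)
  · change gauge K (x * y) ≤ gauge K x * gauge K y
    refine le_mul_of_forall_lt₀ fun a ha b hb => ?_
    obtain ⟨a', ha0, haa, z, hz, rfl⟩ := exists_lt_of_gauge_lt hKa ha
    obtain ⟨b', hb0, hbb, w, hw, rfl⟩ := exists_lt_of_gauge_lt hKa hb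
    have h1 : gauge K (a' • z * b' • w) ≤ a' * b' :=
      gauge_le_of_mem (by positivity) ⟨z * w, hKmul z hz w hw, by
        simp only [smul_mul_smul_comm]⟩
    exact h1.trans (mul_le_mul haa.le hbb.le hb0.le (ha0.le.trans haa.le))

end Gauge

/-! ### Commutative continuous inverse algebras are locally m-convex -/

section Commutative

variable {A : Type*} [CommRing A] [Algebra ℝ A] [TopologicalSpace A] [IsTopologicalRing A]
  [ContinuousSMul ℝ A] [LocallyConvexSpace ℝ A] [IsContinuousInverseAlgebra A]

omit [Algebra ℝ A] [IsTopologicalRing A] [ContinuousSMul ℝ A] [LocallyConvexSpace ℝ A] in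
theorem continuousAt_ringInverse {x : A} (hx : IsUnit x) : ContinuousAt Ring.inverse x :=
  IsContinuousInverseAlgebra.continuousOn_inverse.continuousAt
    (IsContinuousInverseAlgebra.isOpen_units.mem_nhds hx)

/-- The inverse of `1 - x ^ m` is an average `R` of elements close to `1`. Seminorm balls are
convex, so `R` is as close to `1` as these elements are, whatever `m` is. Continuity of inversion at
`1` then makes `x ^ m = 1 - R⁻¹` small, with `p` independent of `m`. -/
theorem exists_seminorm_pow_lt_one {q : Seminorm ℝ A} (hq : Continuous q) :
    ∃ p : Seminorm ℝ A, Continuous p ∧ ∀ x, p x ≤ 1 → ∀ m : ℕ, 0 < m → q (x ^ m) < 1 := by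
  have hopen := (IsContinuousInverseAlgebra.isOpen_units (A := A)).mem_nhds isUnit_one
  have h1 : {w : A | IsUnit (1 + w) ∧ q (Ring.inverse (1 + w) - 1) < 1} ∈ 𝓝 (0 : A) := by
    have hlin : Tendsto (fun w : A => 1 + w) (𝓝 0) (𝓝 1) := by
      have : Continuous fun w : A => 1 + w := by fun_prop
      simpa using this.tendsto 0
    have hinv : Tendsto (fun w : A => q (Ring.inverse (1 + w) - 1)) (𝓝 0) (𝓝 0) := by
      have h2 := ((continuousAt_ringInverse (isUnit_one (M := A))).tendsto.comp hlin).sub_const 1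
      have h3 := (hq.tendsto _).comp h2
      simpa [Function.comp_def] using h3
    exact Filter.inter_mem (hlin hopen) (hinv.eventually (gt_mem_nhds one_pos))
  obtain ⟨q₁, hq₁, hq₁'⟩ := Seminorm.exists_lt_one_subset_of_mem_nhds h1
  -- The pair stands for `(c • x, x)` with `|c| ≤ 1`; treating `c • x` as an independent variable
  -- makes the neighbourhood uniform in the cosines `c`.
  have h2 : {z : A × A | IsUnit (1 - (2 : ℝ) • z.1 + z.2 ^ 2) ∧
      q₁ ((1 - z.1) * Ring.inverse (1 - (2 : ℝ) • z.1 + z.2 ^ 2) - 1) < 1} ∈ 𝓝 (0 : A × A) := by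
    have hlin : Tendsto (fun z : A × A => 1 - (2 : ℝ) • z.1 + z.2 ^ 2) (𝓝 0) (𝓝 1) := by
      have : Continuous fun z : A × A => 1 - (2 : ℝ) • z.1 + z.2 ^ 2 := by fun_prop
      simpa using this.tendsto 0
    have hlin' : Tendsto (fun z : A × A => 1 - z.1) (𝓝 0) (𝓝 1) := by
      have : Continuous fun z : A × A => 1 - z.1 := by fun_prop
      simpa using this.tendsto 0
    have hinv : Tendsto (fun z : A × A =>
        q₁ ((1 - z.1) * Ring.inverse (1 - (2 : ℝ) • z.1 + z.2 ^ 2) - 1)) (𝓝 0) (𝓝 0) := by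
      have h2 := (hlin'.mul
        ((continuousAt_ringInverse (isUnit_one (M := A))).tendsto.comp hlin)).sub_const 1
      have h3 := (hq₁.tendsto _).comp h2
      simpa [Function.comp_def] using h3
    exact Filter.inter_mem (hlin hopen) (hinv.eventually (gt_mem_nhds one_pos))
  rw [← Prod.mk_zero_zero, nhds_prod_eq, Filter.mem_prod_same_iff] at h2
  obtain ⟨V, hV, hVV⟩ := h2
  obtain ⟨p, hp, hpV⟩ := Seminorm.exists_lt_one_subset_of_mem_nhds hV
  -- Doubling turns the closed condition `≤ 1` into the strict inequality `p x < 1`.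
  refine ⟨p + p, hp.add hp, fun x hx m hm => ?_⟩
  have hx : p x + p x ≤ 1 := hx
  have hpx : p x < 1 := by linarith
  have h3 : ∀ c : ℝ, |c| ≤ 1 → IsUnit (1 - (2 * c) • x + x ^ 2) ∧
      q₁ ((1 - c • x) * Ring.inverse (1 - (2 * c) • x + x ^ 2) - 1) < 1 := fun c hc => by
    have hcx : p (c • x) < 1 := by
      rw [map_smul_eq_mul]
      exact (mul_le_of_le_one_left (apply_nonneg _ _) hc).trans_lt hpx
    have := hVV (mk_mem_prod (hpV _ hcx) (hpV _ hpx))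
    simpa [smul_smul] using this
  have hm' : (0 : ℝ) < m := by exact_mod_cast hm
  have h4 := sum_inverse_mul_one_sub_pow (x := x) hm fun k _ => (h3 _ (Real.abs_cos_le_one _)).1
  set R := (m : ℝ)⁻¹ • ∑ k ∈ Finset.range m, (1 - Real.cos (2 * Real.pi * k / m) • x) *
      Ring.inverse (1 - (2 * Real.cos (2 * Real.pi * k / m)) • x + x ^ 2) with hR
  have h5 : R - 1 = (m : ℝ)⁻¹ • ∑ k ∈ Finset.range m, ((1 - Real.cos (2 * Real.pi * k / m) • x) *
      Ring.inverse (1 - (2 * Real.cos (2 * Real.pi * k / m)) • x + x ^ 2) - 1) := by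
    rw [Finset.sum_sub_distrib, smul_sub, ← hR, Finset.sum_const, Finset.card_range,
      ← Nat.cast_smul_eq_nsmul ℝ, smul_smul, inv_mul_cancel₀ hm'.ne', one_smul]
  have h6 : q₁ (R - 1) < 1 := by
    rw [h5, map_smul_eq_mul, Real.norm_of_nonneg (by positivity), inv_mul_lt_iff₀ hm', mul_one]
    refine (Seminorm.map_sum_le q₁ _ _).trans_lt ?_
    calc _ < ∑ _k ∈ Finset.range m, (1 : ℝ) :=
          Finset.sum_lt_sum_of_nonempty (Finset.nonempty_range_iff.2 hm.ne')
            fun k _ => (h3 _ (Real.abs_cos_le_one _)).2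
      _ = m := by simp
  obtain ⟨h7, h8⟩ := hq₁' _ h6
  rw [add_sub_cancel] at h7 h8
  have h9 : Ring.inverse R = 1 - x ^ m := by
    rw [← mul_one (Ring.inverse R), ← congrArg (Ring.inverse R * ·) h4]
    rw [← mul_assoc, Ring.inverse_mul_cancel _ h7, one_mul]
  rwa [h9, sub_sub_cancel_left, map_neg_eq_map] at h8

/-- By polarization, a product of `n` factors is a signed sum of `2 ^ n` powers divided by `n!`.
Each power is at most `n ^ n` in `q`, and `n ^ n ≤ exp n * n!`, so the loss is only exponential in
`n` and rescaling the factors compensates for it. -/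
theorem exists_seminorm_list_prod_le_one {q : Seminorm ℝ A} (hq : Continuous q) :
    ∃ p : Seminorm ℝ A, Continuous p ∧
      ∀ l : List A, l ≠ [] → (∀ x ∈ l, p x ≤ 1) → q l.prod ≤ 1 := by
  obtain ⟨p, hp, h⟩ := exists_seminorm_pow_lt_one hq
  -- The factor `2` pays for the number of subsets and `exp 1` for `n ^ n / n!`.
  set c : ℝ := 2 * Real.exp 1 with hc
  have hc0 : 0 < c := by positivity
  have key : ∀ x, (Real.toNNReal c • p) x = p (c • x) := fun x => by
    rw [_root_.smul_apply, NNReal.smul_def, Real.coe_toNNReal _ hc0.le, smul_eq_mul,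
      map_smul_eq_mul, Real.norm_of_nonneg hc0.le]
  refine ⟨Real.toNNReal c • p, ?_, fun l hl hl1 => ?_⟩
  · have : Continuous fun x => p (c • x) := by fun_prop
    exact this.congr fun x => (key x).symm
  set n := l.length with hn
  have hn0 : 0 < n := List.length_pos_iff.2 hl
  have hn0' : (0 : ℝ) < n := by exact_mod_cast hn0
  let y : Fin n → A := fun i => c • l[i]
  have hy : ∀ i, p (y i) ≤ 1 := fun i => by
    rw [← key]; exact hl1 _ (List.getElem_mem _)
  have hprod : ∏ i, y i = c ^ n • l.prod := by
    have h1 : ∀ i, y i = algebraMap ℝ A c * l[i] := fun i => Algebra.smul_def _ _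
    simp_rw [h1]
    rw [Finset.prod_mul_distrib, Finset.prod_const, Finset.card_univ, Fintype.card_fin,
      Algebra.smul_def, map_pow]
    congr 1
    exact Fin.prod_univ_getElem l
  have hpow : ∀ s : Finset (Fin n), q ((∑ i ∈ s, y i) ^ n) ≤ (n : ℝ) ^ n := fun s => by
    have h1 : p ((n : ℝ)⁻¹ • ∑ i ∈ s, y i) ≤ 1 := by
      rw [map_smul_eq_mul, Real.norm_of_nonneg (by positivity), inv_mul_le_iff₀ hn0', mul_one]
      refine (Seminorm.map_sum_le p _ _).trans ?_
      refine (Finset.sum_le_sum fun i _ => hy i).trans ?_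
      rw [Finset.sum_const, nsmul_eq_mul, mul_one]
      exact_mod_cast (Finset.card_le_univ s).trans (Fintype.card_fin n).le
    have h2 := (h _ h1 n hn0).le
    rwa [smul_pow, map_smul_eq_mul, Real.norm_of_nonneg (by positivity), inv_pow,
      inv_mul_le_iff₀ (by positivity), mul_one] at h2
  have h1 : (n.factorial : ℝ) * (c ^ n * q l.prod) ≤ 2 ^ n * (n : ℝ) ^ n := by
    have h2 : (n.factorial : ℝ) * (c ^ n * q l.prod) = q ((n.factorial : A) * ∏ i, y i) := by
      rw [hprod, ← nsmul_eq_mul (α := A), ← Nat.cast_smul_eq_nsmul ℝ, map_smul_eq_mul, map_smul_eq_mul,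
        Real.norm_of_nonneg (by positivity), Real.norm_of_nonneg (by positivity)]
    rw [h2, factorial_mul_prod_eq_sum_powerset]
    refine (Seminorm.map_sum_le q _ _).trans ?_
    have h3 : ∀ s ∈ (Finset.univ : Finset (Finset (Fin n))),
        q ((-1) ^ (Finset.univ \ s).card * (∑ i ∈ s, y i) ^ n) ≤ (n : ℝ) ^ n := fun s _ => by
      rcases neg_one_pow_eq_or A (Finset.univ \ s).card with h | h
      · rw [h, one_mul]; exact hpow s
      · rw [h, neg_one_mul, map_neg_eq_map]; exact hpow s
    refine (Finset.sum_le_sum h3).trans (le_of_eq ?_)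
    simp
  have h2 := Real.pow_div_factorial_le_exp n hn0'.le n
  rw [div_le_iff₀ (by positivity)] at h2
  have h3 : Real.exp n = Real.exp 1 ^ n := by rw [← Real.exp_nat_mul, mul_one]
  have h4 : (n.factorial : ℝ) * (c ^ n * q l.prod) ≤ (n.factorial : ℝ) * (c ^ n * 1) := by
    refine h1.trans ?_
    rw [hc, mul_pow, ← h3, mul_one]
    calc (2 : ℝ) ^ n * (n : ℝ) ^ n ≤ 2 ^ n * (Real.exp n * n.factorial) := by gcongr
      _ = _ := by ring
  exact le_of_mul_le_mul_left (le_of_mul_le_mul_left h4 (by positivity)) (by positivity)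

theorem isLocallySubmultiplicative_mul_of_comm :
    IsLocallySubmultiplicative (LinearMap.mul ℝ A) := fun q hq => by
  obtain ⟨p, hp, h⟩ := exists_seminorm_list_prod_le_one hq
  exact exists_submultiplicative_of_list_prod hp h

end Commutative

/-! ### The locally m-convex case -/

section MConvex

theorem IsLocallyMConvex.isLocallySubmultiplicative {𝕜 A : Type*} [RCLike 𝕜] [Ring A]
    [Algebra 𝕜 A] [Algebra ℝ A] [IsScalarTower ℝ 𝕜 A] [TopologicalSpace A]
    (h : IsLocallyMConvex 𝕜 A) : IsLocallySubmultiplicative (LinearMap.mul ℝ A) := by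
  obtain ⟨S, hS, hw⟩ := h
  have := hw.topologicalAddGroup
  have := hw.continuousSMul
  intro q hq
  have h1 : {x | q x < 1} ∈ 𝓝 (0 : A) :=
    hq.continuousAt.eventually_lt continuousAt_const (by simp)
  obtain ⟨s, r, hr, hs⟩ := (hw.mem_nhds_iff 0 _).1 h1
  set P := s.sup fun p : S => (p : Seminorm 𝕜 A) with hP
  have hPc : Continuous P :=
    Seminorm.continuous (r := 1) (hw.hasBasis_zero_ball.mem_of_mem (i := (s, 1)) one_pos)
  have hPmul : ∀ x y, P (x * y) ≤ P x * P y := fun x y => by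
    refine Seminorm.finset_sup_apply_le (by positivity) fun p hp => (hS p.1 p.2 x y).trans ?_
    exact mul_le_mul (Seminorm.le_finset_sup_apply hp) (Seminorm.le_finset_sup_apply hp)
      (apply_nonneg _ _) (apply_nonneg _ _)
  -- Otherwise `x` scaled to `q`-value exactly `1` would lie in the `P`-ball of radius `r`, on which
  -- `q < 1`.
  have hqP : ∀ x, q x ≤ r⁻¹ * P x := fun x => by
    by_contra! hlt
    have hx : 0 < q x := lt_of_le_of_lt (by positivity) hlt
    rw [inv_mul_lt_iff₀ hr] at hlt
    have h2 : (q x)⁻¹ • x ∈ P.ball 0 r := by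
      rw [Seminorm.mem_ball_zero]
      have : P ((q x)⁻¹ • x) = (q x)⁻¹ * P x := by
        have := map_smul_eq_mul (P.restrictScalars ℝ) (q x)⁻¹ x
        rwa [Real.norm_of_nonneg (by positivity)] at this
      rw [this, inv_mul_lt_iff₀ hx, mul_comm]
      exact hlt
    have h3 : q ((q x)⁻¹ • x) < 1 := hs h2
    rw [map_smul_eq_mul, Real.norm_of_nonneg (by positivity), inv_mul_cancel₀ hx.ne'] at h3
    exact lt_irrefl _ h3
  -- A multiple of a submultiplicative seminorm stays submultiplicative when the factor is at least
  -- `1`.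
  set C := max r⁻¹ 1 with hC
  have hC1 : 1 ≤ C := le_max_right _ _
  have key : ∀ x, (Real.toNNReal C • P.restrictScalars ℝ) x = C * P x := fun x => by
    rw [_root_.smul_apply, NNReal.smul_def, Real.coe_toNNReal _ (by positivity), smul_eq_mul]
    rfl
  refine ⟨Real.toNNReal C • P.restrictScalars ℝ, ?_, fun x => ?_, fun x y => ?_⟩
  · have : Continuous fun x => C * P x := by fun_prop
    exact this.congr fun x => (key x).symm
  · rw [key]
    exact (hqP x).trans (mul_le_mul_of_nonneg_right (le_max_left _ _) (apply_nonneg _ _))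
  · rw [key, key, key, LinearMap.mul_apply']
    calc C * P (x * y) ≤ C * (P x * P y) := by gcongr; exact hPmul x y
      _ ≤ C * (P x * (C * P y)) := by
          gcongr
          exact le_mul_of_one_le_left (apply_nonneg _ _) hC1
      _ = C * P x * (C * P y) := by ring

end MConvex

/-! ### The unit group as a Lie group -/

section UnitsManifold

variable {A : Type*} [Ring A] [TopologicalSpace A] [IsContinuousInverseAlgebra A]

theorem isOpenEmbedding_unitsVal : Topology.IsOpenEmbedding (Units.val : Aˣ → A) :=
  IsContinuousInverseAlgebra.isOpenEmbedding_val A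

variable (A) in
/-- The chart of the unit group given by the inclusion into the algebra. -/
def unitsChart : OpenPartialHomeomorph Aˣ A :=
  (isOpenEmbedding_unitsVal (A := A)).toOpenPartialHomeomorph

@[simp]
theorem unitsChart_apply (u : Aˣ) : unitsChart A u = u := rfl

theorem unitsChart_target : (unitsChart A).target = {x | IsUnit x} := by
  ext x
  simp [unitsChart, IsUnit]

theorem unitsChart_symm_val {x : A} (hx : IsUnit x) : ((unitsChart A).symm x : A) = x :=
  (unitsChart A).right_inv (by rw [unitsChart_target]; exact hx)

theorem unitsChartAt (u : Aˣ) : chartAt A u = unitsChart A := rfl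

variable [Algebra ℝ A]

theorem IsSmoothOn.congr {E F : Type*} [AddCommGroup E] [Module ℝ E] [TopologicalSpace E]
    [AddCommGroup F] [Module ℝ F] [TopologicalSpace F] {f g : E → F} {U : Set E}
    (hf : IsSmoothOn f U) (h : ∀ x ∈ U, g x = f x) : IsSmoothOn g U := by
  obtain ⟨d, h0, hd, hc⟩ := hf
  exact ⟨d, fun x hx y => (h0 x hx y).trans (h x hx).symm, hd, hc⟩

variable [IsTopologicalRing A] [ContinuousSMul ℝ A]

theorem isLCLieGroup_units [T2Space A] : IsLCLieGroup A Aˣ where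
  t2 := (isOpenEmbedding_unitsVal (A := A)).isEmbedding.t2Space
  compatible := by
    rintro e he e' he'
    obtain rfl : e = unitsChart A := he
    obtain rfl : e' = unitsChart A := he'
    refine IsSmoothOn.congr (f := fun x => x)
      (IsRational.isSmoothOn (.lin (ContinuousLinearMap.fst ℝ A (Fin 0 → A)))) fun x hx => ?_
    exact (unitsChart A).right_inv hx.1
  smooth_mul := by
    let _ : ChartedSpace (A × A) (Aˣ × Aˣ) := prodChartedSpace A Aˣ A Aˣ
    have hval : Continuous fun g : Aˣ × Aˣ => (g.1 : A) * (g.2 : A) :=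
      (isOpenEmbedding_unitsVal.continuous.comp continuous_fst).mul
        (isOpenEmbedding_unitsVal.continuous.comp continuous_snd)
    refine ⟨(isOpenEmbedding_unitsVal (A := A)).isEmbedding.continuous_iff.2 hval, ?_⟩
    rintro e ⟨e₁, he₁, e₂, he₂, rfl⟩ e' he'
    obtain rfl : e₁ = unitsChart A := he₁
    obtain rfl : e₂ = unitsChart A := he₂
    obtain rfl : e' = unitsChart A := he'
    refine IsSmoothOn.congr (f := fun x => x.1 * x.2)
      (IsRational.isSmoothOn (.mul
        (.lin ((ContinuousLinearMap.fst ℝ A A).comp (ContinuousLinearMap.fst ℝ (A × A) _)))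
        (.lin ((ContinuousLinearMap.snd ℝ A A).comp (ContinuousLinearMap.fst ℝ (A × A) _)))))
      fun x hx => ?_
    have h1 := (unitsChart A).right_inv hx.1.1
    have h2 := (unitsChart A).right_inv hx.1.2
    exact congrArg₂ (· * ·) h1 h2
  smooth_inv := by
    have hval : Continuous fun g : Aˣ => ((g⁻¹ : Aˣ) : A) := by
      have h1 : ∀ g : Aˣ, ((g⁻¹ : Aˣ) : A) = Ring.inverse (g : A) := fun g => by simp
      simp_rw [h1]
      exact IsContinuousInverseAlgebra.continuousOn_inverse.comp_continuous
        isOpenEmbedding_unitsVal.continuous fun g => g.isUnit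
    refine ⟨(isOpenEmbedding_unitsVal (A := A)).isEmbedding.continuous_iff.2 hval, ?_⟩
    rintro e he e' he'
    obtain rfl : e = unitsChart A := he
    obtain rfl : e' = unitsChart A := he'
    have hunit : ∀ x ∈ (unitsChart A).target ∩ (unitsChart A).symm ⁻¹'
        ((fun g : Aˣ => g⁻¹) ⁻¹' (unitsChart A).source), IsUnit x := fun x hx => by
      have := hx.1
      rwa [unitsChart_target] at this
    refine IsSmoothOn.congr (f := Ring.inverse) (IsRational.isSmoothOn
      (.inv (ContinuousLinearMap.id ℝ A) hunit)) fun x hx => ?_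
    rw [unitsChart_apply, ← Ring.inverse_unit, unitsChart_symm_val (hunit x hx)]

/-- In the inclusion chart, left translation is the restriction of a linear map, so the difference
quotient is constant as long as `1 + t v` remains invertible. -/
theorem isLeftTranslate_units (g : Aˣ) (v : A) : IsLeftTranslate A g v ((g : A) * v) := by
  have hlin : Tendsto (fun t : ℝ => (1 : A) + t • v) (𝓝[≠] 0) (𝓝 1) := by
    have : Continuous fun t : ℝ => (1 : A) + t • v := by fun_prop
    simpa using (this.tendsto 0).mono_left nhdsWithin_le_nhds
  refine tendsto_const_nhds.congr' ?_
  filter_upwards [hlin (IsContinuousInverseAlgebra.isOpen_units.mem_nhds isUnit_one),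
    self_mem_nhdsWithin] with t ht ht0
  have ht0 : t ≠ 0 := ht0
  have ht : IsUnit ((1 : A) + t • v) := ht
  simp only [unitsChartAt, unitsChart_apply, Units.val_one, Units.val_mul,
    unitsChart_symm_val ht, unitsChart_symm_val isUnit_one]
  rw [← mul_sub, add_sub_cancel_left, mul_smul_comm, smul_smul, inv_mul_cancel₀ ht0, one_smul]

theorem isEvolution_units {γ : I → A} {η : I → Aˣ} (hγ : Continuous γ)
    (hη : Continuous fun t => (η t : A)) (h0 : η 0 = 1)
    (hd : ∀ t, HasCurveDerivAt (fun t => (η t : A)) (η t * γ t) t) : IsEvolution γ η := by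
  refine ⟨⟨(isOpenEmbedding_unitsVal (A := A)).isEmbedding.continuous_iff.2 hη, ?_⟩, h0,
    fun t => ⟨η t * γ t, hd t, isLeftTranslate_units _ _⟩⟩
  rintro e he
  obtain rfl : e = unitsChart A := he
  exact ⟨fun t => η t * γ t, (hη.mul hγ).continuousOn, fun t _ => hd t⟩

end UnitsManifold

/-! ### Invertibility of solutions and regularity -/

section Regularity

variable {A : Type*} [Ring A] [Algebra ℝ A] [TopologicalSpace A] [IsTopologicalRing A]
  [ContinuousSMul ℝ A] [LocallyConvexSpace ℝ A]

omit [ContinuousSMul ℝ A] [LocallyConvexSpace ℝ A] in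
theorem HasCurveDerivAt.mul {f g : I → A} {v w : A} {t : I} (hf : HasCurveDerivAt f v t)
    (hg : HasCurveDerivAt g w t) (hgc : Continuous g) :
    HasCurveDerivAt (fun s => f s * g s) (v * g t + f t * w) t := by
  have h1 : Tendsto g (𝓝[≠] t) (𝓝 (g t)) := (hgc.tendsto t).mono_left nhdsWithin_le_nhds
  refine ((Tendsto.mul hf h1).add (Tendsto.const_mul (f t) hg)).congr fun s => ?_
  rw [smul_mul_assoc, mul_smul_comm, ← smul_add, sub_mul, mul_sub, sub_add_sub_cancel]

theorem IsLocallySubmultiplicative.flip {E : Type*} [AddCommGroup E] [Module ℝ E]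
    [TopologicalSpace E] {m : E →ₗ[ℝ] E →ₗ[ℝ] E}
    (hm : IsLocallySubmultiplicative m) : IsLocallySubmultiplicative m.flip := fun q hq => by
  obtain ⟨p, hp, hqp, hpm⟩ := hm q hq
  exact ⟨p, hp, hqp, fun x y => by rw [LinearMap.flip_apply, mul_comm]; exact hpm y x⟩

variable [T2Space A]

/-- The flipped equation is `ζ' = -γ ζ`, so `(η ζ)' = η γ ζ - η γ ζ = 0` and the product keeps its
initial value `1`. -/
theorem IsSolution.mul_eq_one {γ η ζ : I → A} (hm : IsLocallySubmultiplicative (LinearMap.mul ℝ A))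
    (hγ : Continuous γ) (hη : IsSolution (LinearMap.mul ℝ A) 1 γ η)
    (hζ : IsSolution (LinearMap.mul ℝ A).flip 1 (fun t => -γ t) ζ) (t : I) : η t * ζ t = 1 := by
  have h1 := hη.isWeakPrimitive.hasCurveDerivAt (hm.comp_continuous hη.continuous hγ)
  have h2 := hζ.isWeakPrimitive.hasCurveDerivAt (hm.flip.comp_continuous hζ.continuous hγ.neg)
  have h3 : IsWeakPrimitive (fun t => η t * ζ t) fun _ => 0 := by
    refine IsWeakPrimitive.of_hasCurveDerivAt (hη.continuous.mul hζ.continuous) continuous_const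
      fun t => ?_
    convert (h1 t).mul (h2 t) hζ.continuous using 1
    simp [mul_assoc]
  refine ContinuousLinearMap.eq_of_forall_dual fun φ => ?_
  have h4 := h3 φ t
  have h5 : ∀ u, φ (unitExt (fun _ : I => (0 : A)) u) = 0 := fun u => _root_.map_zero φ
  simp only [h5, intervalIntegral.integral_zero, hη.map_zero, hζ.map_zero, mul_one] at h4
  exact sub_eq_zero.1 h4

/-- Differentiating `ζ η` gives no cancellation, so connectedness is used instead. As `η t` has the
right inverse `ζ t`, the closed condition `ζ t η t = 1` is equivalent to the open condition that `η
t` is a unit; it holds at `0`, hence on all of `[0,1]`. -/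
theorem IsSolution.mul_eq_one' [IsContinuousInverseAlgebra A] {γ η ζ : I → A}
    (hm : IsLocallySubmultiplicative (LinearMap.mul ℝ A))
    (hγ : Continuous γ) (hη : IsSolution (LinearMap.mul ℝ A) 1 γ η)
    (hζ : IsSolution (LinearMap.mul ℝ A).flip 1 (fun t => -γ t) ζ) (t : I) : ζ t * η t = 1 := by
  have h1 := hη.mul_eq_one hm hγ hζ
  have h2 : {t | ζ t * η t = 1} = {t | IsUnit (η t)} := by
    ext t
    constructor
    · exact fun h => ⟨⟨η t, ζ t, h1 t, h⟩, rfl⟩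
    · rintro ⟨u, hu⟩
      have h3 : ζ t = ((u⁻¹ : Aˣ) : A) := by
        rw [← Units.inv_mul_cancel_left u (ζ t), hu, h1, mul_one]
      change ζ t * η t = 1
      rw [h3, ← hu, Units.inv_mul]
  have h4 : IsClopen {t | ζ t * η t = 1} := by
    refine ⟨isClosed_eq (hζ.continuous.mul hη.continuous) continuous_const, ?_⟩
    rw [h2]
    exact IsContinuousInverseAlgebra.isOpen_units.preimage hη.continuous
  have h5 := h4.eq_univ ⟨0, by
    change ζ 0 * η 0 = 1
    rw [hζ.map_zero, hη.map_zero, one_mul]⟩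
  exact h5.symm.subset (mem_univ t)

theorem isRegularLieGroup_units [IsContinuousInverseAlgebra A] (hA : HasLipschitzIntegrals A)
    (hm : IsLocallySubmultiplicative (LinearMap.mul ℝ A)) : IsRegularLieGroup A Aˣ where
  toIsLCLieGroup := isLCLieGroup_units
  exists_evolution := by
    choose η hη using fun γ : SmoothPath A => hA.exists_isSolution hm 1 γ.isSeminormLipschitz
    choose ζ hζ using fun γ : SmoothPath A =>
      hA.exists_isSolution hm.flip 1 (-γ).isSeminormLipschitz
    have h1 : ∀ γ t, η γ t * ζ γ t = 1 := fun γ => (hη γ).mul_eq_one hm γ.continuous (hζ γ)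
    have h2 : ∀ γ t, ζ γ t * η γ t = 1 := fun γ => (hη γ).mul_eq_one' hm γ.continuous (hζ γ)
    have hev : IsEndpointMap (LinearMap.mul ℝ A) 1 fun γ => η γ 1 := fun γ => ⟨η γ, hη γ, rfl⟩
    refine ⟨fun γ t => ⟨η γ t, ζ γ t, h1 γ t, h2 γ t⟩, fun γ => ?_, ?_, ?_⟩
    · exact isEvolution_units γ.continuous (hη γ).continuous (Units.ext (hη γ).map_zero)
        ((hη γ).isWeakPrimitive.hasCurveDerivAt (hm.comp_continuous (hη γ).continuous γ.continuous))
    · exact (isOpenEmbedding_unitsVal (A := A)).isEmbedding.continuous_iff.2 (hev.continuous hm)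
    · rintro e he e' he'
      obtain rfl : e = OpenPartialHomeomorph.refl _ := he
      obtain rfl : e' = unitsChart A := he'
      exact hev.isSmoothOn hA hm _

end Regularity

end

theorem mainTheorem2 {𝕜 A : Type*} [RCLike 𝕜] [Ring A] [Algebra 𝕜 A]
    [Algebra ℝ A] [IsScalarTower ℝ 𝕜 A]
    [TopologicalSpace A] [T2Space A] [IsTopologicalRing A]
    [ContinuousSMul 𝕜 A] [ContinuousSMul ℝ A] [LocallyConvexSpace ℝ A]
    [IsContinuousInverseAlgebra A]
    (hM : IsMackeyComplete A)
    (h : (∀ x y : A, x * y = y * x) ∨ IsLocallyMConvex 𝕜 A) :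
    IsRegularLieGroup A Aˣ := by
  refine isRegularLieGroup_units hM.hasLipschitzIntegrals ?_
  rcases h with h | h
  · let _ : CommRing A := { ‹Ring A› with mul_comm := h }
    exact isLocallySubmultiplicative_mul_of_comm
  · exact h.isLocallySubmultiplicative
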